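/- Let $R$ be a division ring and let $V$ be a left vector space over $R$ of finite dimension $n=2k\ge 8$. Let $\mathfrak G_k$ be the set of all pairs $(S,U)$ of $k$-dimensional subspaces of $V$ with $S+U=V$; the opposite of $\alpha=(S,U)$ is $\alpha^{op}=(U,S)$. For a base $B$ of $V$, the base subset of $\mathfrak G_k$ associated with $B$ is the set of all $(S,U)\in\mathfrak G_k$ such that both $S$ and $U$ are spanned by vectors of $B$. A bijection $f:\mathfrak G_k\to\mathfrak G_k$ preserves the class of base subsets if both $f$ and $f^{-1}$ send base subsets to base subsets. Let $\overline{\mathfrak G}_k$ be the set of all two-element subsets $\{\alpha,\alpha^{op}\}$ of $\mathfrak G_k$. A semilinear isomorphism $l:V\to V$ induces the bijection $(S,U)\mapsto(l(S),l(U))$ of $\mathfrak G_k$, and a semilinear isomorphism $s:V\to V^*$ (relative to an isomorphism of $R$ onto the opposite ring) induces the bijection $(S,U)\mapsto(s(U)^0,s(S)^0)$, where $W^0\subset V$ is the annihilator of $W\subset V^*$; both also induce bijections of $\overline{\mathfrak G}_k$. Let $Op$ be the group of all transformations of $\mathfrak G_k$ that, for some subset $\mathcal X\subset\mathfrak G_k$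 closed under $\alpha\mapsto\alpha^{op}$, send each element of $\mathcal X$ to its opposite and fix all other elements. (i) Let $f$ be a bijection of $\mathfrak G_k$ preserving the class of base subsets. Then two elements $\alpha,\beta$ of $\mathfrak G_k$ are opposite if and only if $f(\alpha),f(\beta)$ are opposite, so that $f$ defines a bijection $\{\alpha,\alpha^{op}\}\mapsto\{f(\alpha),f(\alpha^{op})\}$ of $\overline{\mathfrak G}_k$; and this bijection of $\overline{\mathfrak G}_k$ is induced by a semilinear isomorphism $V\to V$ or $V\to V^*$. (ii) Equivalently, the group of all bijections of $\mathfrak G_k$ preserving the class of base subsets is generated by $Op$ together with all transformations of $\mathfrak G_k$ induced by semilinear isomorphisms $V\to V$ and $V\to V^*$, and the kernel of the action of this group on $\overline{\mathfrak G}_k$ is $Op$. -/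

import Mathlib

/-- The set `𝔊 k` of all pairs `(S, U)` of subspaces of `V` with `dim S = k`,
`dim U = n - k` and `S + U = V`, where `n = dim V`. (It is empty when `k > n`.) -/
@[ext]
structure GrassPair (R V : Type*) [DivisionRing R] [AddCommGroup V] [Module R V] (k : ℕ) where
  /-- the `k`-dimensional component -/
  fst : Submodule R V
  /-- the `(n - k)`-dimensional component -/
  snd : Submodule R V
  finrank_fst : Module.finrank R fst = k
  finrank_snd : Module.finrank R snd = Module.finrank R V - k
  sup_eq_top : fst ⊔ snd = ⊤

namespace GrassPair

variable {R V : Type*} [DivisionRing R] [AddCommGroup V] [Module R V] {k : ℕ}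

/-- The base subset of `𝔊 k` associated with a base `b` of `V`: all pairs both of whose
components are spanned by vectors of the base. -/
def baseSubset (k : ℕ) (b : Module.Basis (Fin (Module.finrank R V)) R V) :
    Set (GrassPair R V k) :=
  {α | (∃ I : Set (Fin (Module.finrank R V)), α.fst = Submodule.span R (b '' I)) ∧
       (∃ J : Set (Fin (Module.finrank R V)), α.snd = Submodule.span R (b '' J))}

/-- `A` is a base subset of `𝔊 k`. -/
def IsBaseSubset (A : Set (GrassPair R V k)) : Prop :=
  ∃ b : Module.Basis (Fin (Module.finrank R V)) R V, A = baseSubset k b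

variable (R V k) in
/-- The group of all bijective transformations of `𝔊 k` preserving the class of base subsets:
both `f` and its inverse send base subsets to base subsets. -/
def baseGroup : Subgroup (Equiv.Perm (GrassPair R V k)) where
  carrier := {f | ∀ A : Set (GrassPair R V k), IsBaseSubset (f '' A) ↔ IsBaseSubset A}
  one_mem' := fun A => by simp
  mul_mem' := fun {f g} hf hg A => by
    rw [Equiv.Perm.coe_mul, Set.image_comp, hf, hg]
  inv_mem' := fun {f} hf A => by
    rw [← hf, ← Set.image_comp, ← Equiv.Perm.coe_mul, mul_inv_cancel, Equiv.Perm.coe_one,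
      Set.image_id]

/-- `β` is the opposite element `α^op = (U, S)` of `α = (S, U)`. -/
def IsOpposite (α β : GrassPair R V k) : Prop :=
  β.fst = α.snd ∧ β.snd = α.fst

variable (R V k) in
/-- The set of all two-element subsets `{α, α^op}` of `𝔊 k`. -/
def oppositePairs : Set (Set (GrassPair R V k)) :=
  {A | ∃ α β : GrassPair R V k, IsOpposite α β ∧ A = {α, β}}

variable (R V k) in
/-- The transformations attached to subsets `X` of `𝔊 k` closed under passing to the opposite
element: every element of `X` is sent to its opposite and every other element is fixed. -/
def opTransformations : Set (Equiv.Perm (GrassPair R V k)) :=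
  {f | ∃ X : Set (GrassPair R V k),
    (∀ α β, α ∈ X → IsOpposite α β → β ∈ X) ∧
    (∀ α ∈ X, IsOpposite α (f α)) ∧ (∀ α ∉ X, f α = α)}

/-- The annihilator in `V` of a subspace of the dual space. For a left vector space `V` over `R`
the dual space `V →ₗ[R] R` is a right vector space over `R`, that is, a vector space over `Rᵐᵒᵖ`. -/
def annihilator (W : Submodule Rᵐᵒᵖ (Module.Dual R V)) : Submodule R V where
  carrier := {v | ∀ φ ∈ W, φ v = 0}
  zero_mem' := fun φ _ => map_zero φ
  add_mem' := fun {v w} hv hw φ hφ => by rw [map_add, hv φ hφ, hw φ hφ, add_zero]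
  smul_mem' := fun a v hv φ hφ => by rw [map_smul, hv φ hφ, smul_zero]

/-- `f` is induced by a semilinear isomorphism `l : V → V`: it is `(S, U) ↦ (l(S), l(U))`. -/
def InducedBySemilinearAut (f : Equiv.Perm (GrassPair R V k)) : Prop :=
  ∃ (σ : R ≃+* R) (l : V →ₛₗ[(σ : R →+* R)] V), Function.Bijective l ∧
    ∀ α : GrassPair R V k, (f α).fst = α.fst.map l ∧ (f α).snd = α.snd.map l

/-- `f` is induced by a semilinear isomorphism `s : V → V*`:
it is `(S, U) ↦ (s(U)⁰, s(S)⁰)`. -/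
def InducedBySemilinearDual (f : Equiv.Perm (GrassPair R V k)) : Prop :=
  ∃ (σ : R ≃+* Rᵐᵒᵖ) (s : V →ₛₗ[(σ : R →+* Rᵐᵒᵖ)] Module.Dual R V), Function.Bijective s ∧
    ∀ α : GrassPair R V k,
      (f α).fst = annihilator (α.snd.map s) ∧ (f α).snd = annihilator (α.fst.map s)

variable (R V k) in
/-- All transformations of `𝔊 k` induced by semilinear isomorphisms of `V` to itself or to the
dual space. -/
def semilinearTransformations : Set (Equiv.Perm (GrassPair R V k)) :=
  {f | InducedBySemilinearAut f ∨ InducedBySemilinearDual f}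

end GrassPair

/-!
Transformations of the set of pairs of complementary `k`-dimensional subspaces of a space `V` of
dimension `n = 2k ≥ 8` that preserve the class of base subsets.

Restricted to one base subset, such a transformation `f` is a bijection between the `k`-subsets of
two index sets of size `n`. The subsets of a base subset contained in a second base subset are
those failing to separate some pair of indices (`exists_pair_of_subset`, `exists_baseSubset_ne`),
and this is a condition respected by `f`. Hence `f` induces a bijection of pairs of indices that
takes triangles to triangles, so it comes from a permutation of indices (`exists_perm_of_pairs`),
and `f` is, up to passing to opposites, the map of `k`-subsets given by this permutation. Each
basis `b` is thereby carried to a basis `c`, index by index (`Transports`, `exists_transports`).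

If two bases differ only inside one coordinate plane, their base subsets have enough elements in
common to show that the lines outside this plane and the hyperplanes complementary to them have the
same images. Any two bases with a common line and a common complementary hyperplane are joined by
changes of this kind, so `f` induces a bijection of the antiflags of `V`, that is, of the pairs
formed by a point and a hyperplane not through it (`exists_antiflag_equiv`). It preserves the
relation of commuting, namely of being adapted to a common basis. Double commutants detect whether
two antiflags share a point or a hyperplane (`Antiflag.share_iff`), and it follows that the
bijection comes from an isomorphism or an anti-isomorphism of the lattice of subspaces
(`Antiflag.exists_orderIso_or_antiIso`). The latter is handled by the former through the order dual;
this is why antiflags are treated in abstract lattices.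

By the fundamental theorem of projective geometry (`exists_semilinear_of_orderIso`), applied to `V`
and `V` or to `V` and its dual space, the lattice map is induced by a semilinear isomorphism. So `f`
agrees up to opposites with a semilinear transformation `g`, and `g⁻¹ * f` fixes all pairs of
opposite elements, which means that it belongs to `Op` (`mem_opTransformations_iff`).
-/


/-! ### Antiflags in projective lattices -/

/-- Lattices of subspaces of a projective geometry in which all lines have at least three points:
no element is covered by two elements not above it, nor dually; moreover two points do not span
everything, and dually. The notion is invariant under passing to the order dual. -/
class ProjectiveLattice (L : Type*) [CompleteLattice L] : Prop where
  exists_atom : ∀ {x a b : L}, ¬x ≤ a → ¬x ≤ b → ∃ p, IsAtom p ∧ p ≤ x ∧ ¬p ≤ a ∧ ¬p ≤ b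
  exists_coatom : ∀ {x a b : L}, ¬a ≤ x → ¬b ≤ x → ∃ h, IsCoatom h ∧ x ≤ h ∧ ¬a ≤ h ∧ ¬b ≤ h
  inf_ne_bot : ∀ {h h' : L}, IsCoatom h → IsCoatom h' → h ⊓ h' ≠ ⊥
  sup_ne_top : ∀ {p p' : L}, IsAtom p → IsAtom p' → p ⊔ p' ≠ ⊤

instance (L : Type*) [CompleteLattice L] [ProjectiveLattice L] : ProjectiveLattice Lᵒᵈ where
  exists_atom {x a b} h₁ h₂ := by
    obtain ⟨h, hh, h1, h2, h3⟩ := ProjectiveLattice.exists_coatom (L := L)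
      (x := OrderDual.ofDual x) (a := OrderDual.ofDual a) (b := OrderDual.ofDual b) h₁ h₂
    exact ⟨OrderDual.toDual h, hh.dual, h1, h2, h3⟩
  exists_coatom {x a b} h₁ h₂ := by
    obtain ⟨h, hh, h1, h2, h3⟩ := ProjectiveLattice.exists_atom (L := L)
      (x := OrderDual.ofDual x) (a := OrderDual.ofDual a) (b := OrderDual.ofDual b) h₁ h₂
    exact ⟨OrderDual.toDual h, hh.dual, h1, h2, h3⟩
  inf_ne_bot {h h'} h₁ h₂ := ProjectiveLattice.sup_ne_top (L := L) (isCoatom_dual_iff_isAtom.1 h₁)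
    (isCoatom_dual_iff_isAtom.1 h₂)
  sup_ne_top {h h'} h₁ h₂ := ProjectiveLattice.inf_ne_bot (L := L) (isAtom_dual_iff_isCoatom.1 h₁)
    (isAtom_dual_iff_isCoatom.1 h₂)

/-- A point together with a hyperplane not passing through it. -/
@[ext]
structure Antiflag (L : Type*) [CompleteLattice L] where
  /-- the point -/
  pt : L
  /-- the hyperplane -/
  hyp : L
  isAtom : IsAtom pt
  isCoatom : IsCoatom hyp
  not_le : ¬pt ≤ hyp

namespace Antiflag

variable {M M' L L' : Type*} [CompleteLattice M] [CompleteLattice M'] [CompleteLattice L]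
  [CompleteLattice L']

variable (L) in
/-- Passing to the order dual exchanges the point and the hyperplane. -/
def dual : Antiflag L ≃ Antiflag Lᵒᵈ where
  toFun α := ⟨OrderDual.toDual α.hyp, OrderDual.toDual α.pt, α.isCoatom.dual, α.isAtom.dual,
    α.not_le⟩
  invFun α := ⟨OrderDual.ofDual α.hyp, OrderDual.ofDual α.pt,
    isCoatom_dual_iff_isAtom.1 α.isCoatom, isAtom_dual_iff_isCoatom.1 α.isAtom, α.not_le⟩
  left_inv _ := rfl
  right_inv _ := rfl

/-- Two antiflags commute if the point of each lies on the hyperplane of the other. -/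
def Comm (α β : Antiflag L) : Prop := α.pt ≤ β.hyp ∧ β.pt ≤ α.hyp

/-- `γ` belongs to the double commutant of `{α, β}`. -/
def Line (α β γ : Antiflag L) : Prop := ∀ δ : Antiflag L, Comm δ α → Comm δ β → Comm δ γ

/-- Two antiflags share their point or their hyperplane. -/
def Share (α β : Antiflag L) : Prop := α.pt = β.pt ∨ α.hyp = β.hyp

lemma comm_dual {α β : Antiflag L} : Comm (dual L α) (dual L β) ↔ Comm α β :=
  ⟨fun h => ⟨h.2, h.1⟩, fun h => ⟨h.2, h.1⟩⟩

lemma share_dual {α β : Antiflag L} : Share (dual L α) (dual L β) ↔ Share α β := Or.comm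

/-- The double commutant is described by `Comm` alone, so bijections preserving `Comm`
preserve it. -/
lemma line_map {g : Antiflag L ≃ Antiflag L'} (hg : ∀ α β, Comm (g α) (g β) ↔ Comm α β)
    {α β γ : Antiflag L} : Line (g α) (g β) (g γ) ↔ Line α β γ := by
  simp only [Line, g.forall_congr_right.symm, hg]

lemma line_dual {α β γ : Antiflag L} : Line (dual L α) (dual L β) (dual L γ) ↔ Line α β γ :=
  line_map (fun _ _ => comm_dual)

lemma line_of_le {α β γ : Antiflag L} (h₁ : γ.pt ≤ α.pt ⊔ β.pt) (h₂ : α.hyp ⊓ β.hyp ≤ γ.hyp) :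
    Line α β γ := fun _ hα hβ =>
  ⟨(le_inf hα.1 hβ.1).trans h₂, h₁.trans (sup_le hα.2 hβ.2)⟩

lemma pt_not_le_bot (α : Antiflag L) : ¬α.pt ≤ ⊥ := fun h => α.isAtom.1 (le_bot_iff.1 h)

lemma pt_le_iff {p : L} (α : Antiflag L) (hp : IsAtom p) : p ≤ α.pt ↔ p = α.pt :=
  α.isAtom.le_iff_eq hp.1

variable [ProjectiveLattice L] [ProjectiveLattice L']

open ProjectiveLattice

lemma hyp_not_le_bot (α : Antiflag L) : ¬α.hyp ≤ ⊥ := fun h =>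
  inf_ne_bot α.isCoatom α.isCoatom (by simpa using h)

/-- If two antiflags have a common point, then so do all members of their double commutant, and
the hyperplanes of the latter belong to the pencil of the two given hyperplanes. -/
lemma Line.of_pt_eq {α β γ : Antiflag L} (hp : α.pt = β.pt) (h : Line α β γ) :
    γ.pt = α.pt ∧ α.hyp ⊓ β.hyp ≤ γ.hyp := by
  have key : α.hyp ⊓ β.hyp ≤ γ.hyp := by
    by_contra hK
    obtain ⟨x, hx, hxK, hxγ, -⟩ := exists_atom hK hK
    have hxp : ¬x ≤ α.pt := fun hle => by
      rw [pt_le_iff _ hx] at hle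
      exact α.not_le (hle ▸ hxK.trans inf_le_left)
    obtain ⟨y, hy, hpy, hxy, -⟩ := exists_coatom hxp hxp
    exact hxγ (h ⟨x, y, hx, hy, hxy⟩ ⟨hxK.trans inf_le_left, hpy⟩
      ⟨hxK.trans inf_le_right, hp ▸ hpy⟩).1
  refine ⟨?_, key⟩
  by_contra hne
  have h1 : ¬γ.pt ≤ α.pt := by rwa [pt_le_iff _ γ.isAtom]
  have h2 : ¬α.hyp ⊓ β.hyp ≤ α.pt := fun hle => by
    rcases α.isAtom.le_iff.1 hle with h0 | h0
    · exact inf_ne_bot α.isCoatom β.isCoatom h0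
    · exact α.not_le (h0 ▸ inf_le_left)
  obtain ⟨y, hy, hpy, hγy, hKy⟩ := exists_coatom h1 h2
  obtain ⟨x, hx, hxK, hxy, -⟩ := exists_atom hKy hKy
  exact hγy (h ⟨x, y, hx, hy, hxy⟩ ⟨hxK.trans inf_le_left, hpy⟩
      ⟨hxK.trans inf_le_right, hp ▸ hpy⟩).2

section Modular

variable [IsModularLattice L] [IsModularLattice L']

lemma Line.symm_of_pt_eq {α β γ : Antiflag L} (hp : α.pt = β.pt) (hαβ : α ≠ β)
    (h : Line α β γ) (hγ : γ ≠ α) : Line α γ β := by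
  obtain ⟨h1, h2⟩ := h.of_pt_eq hp
  refine line_of_le (hp ▸ le_sup_left) ?_
  have hne : α.hyp ≠ β.hyp := fun h' => hαβ (Antiflag.ext hp h')
  have hne' : γ.hyp ≠ α.hyp := fun h' => hγ (Antiflag.ext h1 h')
  have hcov : α.hyp ⊓ β.hyp ⋖ α.hyp := by
    refine inf_covBy_of_covBy_sup_right ?_
    rw [show α.hyp ⊔ β.hyp = ⊤ from α.isCoatom.2 _ (left_lt_sup.2 fun h' =>
      hne (β.isCoatom.le_iff_eq α.isCoatom.1 |>.1 h'))]
    exact β.isCoatom.covBy_top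
  have hlt : α.hyp ⊓ γ.hyp < α.hyp := inf_lt_left.2 fun h' =>
    hne' (α.isCoatom.le_iff_eq γ.isCoatom.1 |>.1 h')
  rw [(hcov.eq_or_eq (le_inf inf_le_left h2) hlt.le).resolve_right hlt.ne]
  exact inf_le_right

lemma Line.symm_of_hyp_eq {α β γ : Antiflag L} (hp : α.hyp = β.hyp) (hαβ : α ≠ β)
    (h : Line α β γ) (hγ : γ ≠ α) : Line α γ β :=
  line_dual.1 (Line.symm_of_pt_eq (L := Lᵒᵈ) (α := dual L α) (β := dual L β) (γ := dual L γ) hp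
    ((dual L).injective.ne hαβ) (line_dual.2 h) ((dual L).injective.ne hγ))

/-- Sharing the point or the hyperplane is expressed by commutation alone: it means that the
double commutant of the pair is spanned by any two of its elements one of which is `α`. -/
lemma share_iff {α β : Antiflag L} (hαβ : α ≠ β) :
    Share α β ↔ ∀ γ, Line α β γ → γ ≠ α → Line α γ β := by
  refine ⟨fun h γ hγ hne => h.elim (fun hp => hγ.symm_of_pt_eq hp hαβ hne)
    (fun hp => hγ.symm_of_hyp_eq hp hαβ hne), fun h => ?_⟩
  by_contra hS
  obtain ⟨hp, hh⟩ := not_or.1 hS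
  have hh' : ¬α.hyp ≤ β.hyp := fun h' => hh (α.isCoatom.le_iff_eq β.isCoatom.1 |>.1 h').symm
  -- A third hyperplane through `α.hyp ⊓ β.hyp` missing `α.pt`, paired with `α.pt`, lies on the
  -- line of `α` and `β`, while the line it spans with `α` consists of pairs with point `α.pt`.
  have aux : ∀ y, IsCoatom y → α.hyp ⊓ β.hyp ≤ y → ¬α.pt ≤ y → y ≠ α.hyp → False := by
    intro y hy hle hpy hne
    let γ : Antiflag L := ⟨α.pt, y, α.isAtom, hy, hpy⟩
    exact hp (Line.of_pt_eq (α := α) (β := γ) rfl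
      (h γ (line_of_le le_sup_left hle) fun e => hne (congrArg hyp e))).1.symm
  by_cases h1 : α.pt ≤ β.hyp
  · obtain ⟨y, hy, hle, h2, h3⟩ := exists_coatom (x := α.hyp ⊓ β.hyp) (a := α.hyp)
      (b := α.pt ⊔ α.hyp ⊓ β.hyp) (fun h' => hh' (h'.trans inf_le_right))
      (fun h' => α.not_le ((le_sup_left.trans h').trans inf_le_left))
    exact aux y hy hle (fun h' => h3 (sup_le h' hle)) (fun e => h2 e.ge)
  · exact aux β.hyp β.isCoatom inf_le_right h1 (Ne.symm hh)

lemma share_map {g : Antiflag L ≃ Antiflag L'} (hg : ∀ α β, Comm (g α) (g β) ↔ Comm α β)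
    {α β : Antiflag L} : Share (g α) (g β) ↔ Share α β := by
  by_cases hαβ : α = β
  · subst hαβ; simp [Share]
  · rw [share_iff hαβ, share_iff (g.injective.ne hαβ)]
    simp only [g.forall_congr_right.symm, line_map hg, g.injective.ne_iff]

end Modular

/-! ### Maps preserving the relation of sharing a point or a hyperplane -/

/-- `g` maps antiflags sharing the point (hyperplane) with `α` to antiflags sharing the point
(hyperplane) with `g α`. -/
def Straight (g : Antiflag M ≃ Antiflag M') (α : Antiflag M) : Prop :=
  ∀ β, (α.pt = β.pt → (g α).pt = (g β).pt) ∧ (α.hyp = β.hyp → (g α).hyp = (g β).hyp)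

/-- The antiflags sharing something with `α` fall into two cliques, by point and by hyperplane,
with no relation between them. So one example decides to which clique each of them goes. -/
lemma straight_of_pt_eq {g : Antiflag M ≃ Antiflag M'}
    (hg : ∀ α β, Share (g α) (g β) ↔ Share α β) {α β : Antiflag M} (hne : β ≠ α)
    (hp : α.pt = β.pt) (hgp : (g α).pt = (g β).pt) : Straight g α := by
  have hh : α.hyp ≠ β.hyp := fun e => hne (Antiflag.ext hp e).symm
  have hgh : (g α).hyp ≠ (g β).hyp := fun e => hne (g.injective (Antiflag.ext hgp e)).symm
  intro γ
  constructor
  · intro h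
    have h1 := (hg α γ).2 (Or.inl h)
    have h2 := (hg β γ).2 (Or.inl (hp.symm.trans h))
    rcases h1 with h1 | h1
    · exact h1
    · rcases h2 with h2 | h2
      · exact hgp.trans h2
      · exact absurd (h1.trans h2.symm) hgh
  · intro h
    rcases (hg α γ).2 (Or.inr h) with h1 | h1
    · rcases (hg β γ).1 (Or.inl (hgp.symm.trans h1)) with h2 | h2
      · rw [Antiflag.ext (hp.trans h2) h]
      · exact absurd (h.trans h2.symm) hh
    · exact h1

lemma exists_ne_pt_eq (α : Antiflag L) : ∃ β : Antiflag L, β ≠ α ∧ α.pt = β.pt := by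
  obtain ⟨y, hy, -, h1, h2⟩ := exists_coatom α.pt_not_le_bot α.hyp_not_le_bot
  exact ⟨⟨α.pt, y, α.isAtom, hy, h1⟩, fun e => h2 (congrArg hyp e).ge, rfl⟩

lemma straight_or {g : Antiflag L ≃ Antiflag M'} (hg : ∀ α β, Share (g α) (g β) ↔ Share α β)
    (α : Antiflag L) : Straight g α ∨ Straight (g.trans (dual M')) α := by
  obtain ⟨β, hne, hp⟩ := exists_ne_pt_eq α
  rcases (hg α β).2 (Or.inl hp) with h | h
  · exact Or.inl (straight_of_pt_eq hg hne hp h)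
  · exact Or.inr (straight_of_pt_eq (g := g.trans (dual M'))
      (fun α β => share_dual.trans (hg α β)) hne hp h)

lemma Straight.of_share {g : Antiflag L ≃ Antiflag M'}
    (hg : ∀ α β, Share (g α) (g β) ↔ Share α β) {α β : Antiflag L} (h : Straight g α)
    (hS : Share α β) : Straight g β := by
  by_cases hne : α = β
  · exact hne ▸ h
  refine (straight_or hg β).resolve_right fun h' => hne (g.injective ?_)
  rcases hS with hS | hS
  · exact Antiflag.ext ((h β).1 hS) (OrderDual.toDual.injective ((h' α).1 hS.symm)).symm
  · exact Antiflag.ext (OrderDual.toDual.injective ((h' α).2 hS.symm)).symm ((h β).2 hS)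

/-- Any two antiflags are joined by a path along which consecutive members share the point or
the hyperplane, so the behaviour at one antiflag is the behaviour everywhere. -/
lemma Straight.all {g : Antiflag L ≃ Antiflag M'}
    (hg : ∀ α β, Share (g α) (g β) ↔ Share α β) {α : Antiflag L} (h : Straight g α)
    (β : Antiflag L) : Straight g β := by
  obtain ⟨y, hy, -, h1, h2⟩ := exists_coatom α.pt_not_le_bot β.pt_not_le_bot
  have hα' := h.of_share (β := ⟨α.pt, y, α.isAtom, hy, h1⟩) hg (Or.inl rfl)
  have hβ' := hα'.of_share (β := ⟨β.pt, y, β.isAtom, hy, h2⟩) hg (Or.inr rfl)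
  exact hβ'.of_share hg (Or.inl rfl)

lemma straight_all_or {g : Antiflag L ≃ Antiflag M'}
    (hg : ∀ α β, Share (g α) (g β) ↔ Share α β) :
    (∀ α, Straight g α) ∨ ∀ α, Straight (g.trans (dual M')) α := by
  by_cases h : ∃ α, Straight g α
  · exact Or.inl (h.choose_spec.all hg)
  · exact Or.inr fun α => (straight_or hg α).resolve_left fun h' => h ⟨α, h'⟩

lemma Straight.symm_all {g : Antiflag M ≃ Antiflag L'}
    (hg : ∀ α β, Share (g α) (g β) ↔ Share α β) (h : ∀ α, Straight g α) (α : Antiflag L') :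
    Straight g.symm α := by
  have hg' : ∀ α β, Share (g.symm α) (g.symm β) ↔ Share α β := fun α β => by
    simpa using (hg (g.symm α) (g.symm β)).symm
  obtain ⟨β, hne, hp⟩ := exists_ne_pt_eq α
  refine straight_of_pt_eq hg' hne hp ?_
  refine ((hg' α β).2 (Or.inl hp)).resolve_right fun h' => hne ?_
  have := (h (g.symm α) (g.symm β)).2 h'
  rw [g.apply_symm_apply, g.apply_symm_apply] at this
  exact (Antiflag.ext hp this).symm

/-! ### From antiflags to subspaces -/

/-- The map of the lattices induced by a straight transformation of antiflags. -/
def extend (g : Antiflag M ≃ Antiflag M') (x : M) : M' :=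
  ⨆ α : {α : Antiflag M // α.pt ≤ x}, (g α.1).pt

lemma exists_pt_eq {p : L} (hp : IsAtom p) : ∃ α : Antiflag L, α.pt = p := by
  have h : ¬p ≤ ⊥ := fun h => hp.1 (le_bot_iff.1 h)
  obtain ⟨y, hy, -, h1, -⟩ := exists_coatom h h
  exact ⟨⟨p, y, hp, hy, h1⟩, rfl⟩

lemma le_of_forall_pt {x y : L} (h : ∀ α : Antiflag L, α.pt ≤ x → α.pt ≤ y) : x ≤ y := by
  by_contra hxy
  obtain ⟨p, hp, h1, h2, -⟩ := exists_atom hxy hxy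
  obtain ⟨α, rfl⟩ := exists_pt_eq hp
  exact h2 (h α h1)

lemma pt_le_hyp_map {g : Antiflag L ≃ Antiflag M'} (hg : ∀ α β, Comm (g α) (g β) ↔ Comm α β)
    (hs : ∀ α, Straight g α) {α β : Antiflag L} (h : α.pt ≤ β.hyp) :
    (g α).pt ≤ (g β).hyp := by
  -- Replace `α.hyp` and `β.pt` so that the two antiflags commute.
  obtain ⟨y, hy, -, h1, h2⟩ := exists_coatom α.pt_not_le_bot β.hyp_not_le_bot
  have hyβ : ¬y ≤ β.hyp := fun h' => h2 (hy.le_iff_eq β.isCoatom.1 |>.1 h').le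
  obtain ⟨x, hx, hxy, hxβ, -⟩ := exists_atom hyβ hyβ
  let α' : Antiflag L := ⟨α.pt, y, α.isAtom, hy, h1⟩
  let β' : Antiflag L := ⟨x, β.hyp, hx, β.isCoatom, hxβ⟩
  rw [(hs α α').1 rfl, (hs β β').2 rfl]
  exact ((hg α' β').2 ⟨h, hxy⟩).1

lemma pt_le_extend_iff {g : Antiflag L ≃ Antiflag M'}
    (hg : ∀ α β, Comm (g α) (g β) ↔ Comm α β) (hs : ∀ α, Straight g α) {α : Antiflag L} {x : L} :
    (g α).pt ≤ extend g x ↔ α.pt ≤ x := by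
  refine ⟨fun h => ?_, fun h => le_iSup (fun α : {α : Antiflag L // α.pt ≤ x} => (g α.1).pt) ⟨α, h⟩⟩
  by_contra hx
  obtain ⟨y, hy, hxy, h1, -⟩ := exists_coatom hx hx
  let β : Antiflag L := ⟨α.pt, y, α.isAtom, hy, h1⟩
  have h2 : extend g x ≤ (g β).hyp := iSup_le fun γ => pt_le_hyp_map hg hs (γ.2.trans hxy)
  exact (g β).not_le ((hs α β).1 rfl ▸ h.trans h2)

lemma exists_orderIso {g : Antiflag L ≃ Antiflag L'} (hg : ∀ α β, Comm (g α) (g β) ↔ Comm α β)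
    (hS : ∀ α β, Share (g α) (g β) ↔ Share α β) (hs : ∀ α, Straight g α) :
    ∃ Φ : L ≃o L', ∀ α, Φ α.pt = (g α).pt := by
  have hg' : ∀ α β, Comm (g.symm α) (g.symm β) ↔ Comm α β := fun α β => by
    simpa using (hg (g.symm α) (g.symm β)).symm
  have hs' := Straight.symm_all hS hs
  have key : ∀ (β : Antiflag L') (x : L), β.pt ≤ extend g x ↔ (g.symm β).pt ≤ x := fun β x => by
    simpa using pt_le_extend_iff hg hs (α := g.symm β) (x := x)
  have key' : ∀ (α : Antiflag L) (y : L'), α.pt ≤ extend g.symm y ↔ (g α).pt ≤ y := fun α y => by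
    simpa using pt_le_extend_iff hg' hs' (α := g α) (x := y)
  have hle : ∀ x y, extend g x ≤ extend g y ↔ x ≤ y := fun x y =>
    ⟨fun h => le_of_forall_pt fun α hα => (pt_le_extend_iff hg hs).1
      (((pt_le_extend_iff hg hs).2 hα).trans h),
    fun h => le_of_forall_pt fun β hβ => (key _ _).2 (((key _ _).1 hβ).trans h)⟩
  refine ⟨{ toFun := extend g, invFun := extend g.symm, left_inv := fun x => ?_,
            right_inv := fun y => ?_, map_rel_iff' := hle _ _ }, fun α => ?_⟩
  · exact le_antisymm (le_of_forall_pt fun α hα => (pt_le_extend_iff hg hs).1 ((key' _ _).1 hα))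
      (le_of_forall_pt fun α hα => (key' _ _).2 ((pt_le_extend_iff hg hs).2 hα))
  · exact le_antisymm
      (le_of_forall_pt fun β hβ => by simpa using (key' _ _).1 ((key _ _).1 hβ))
      (le_of_forall_pt fun β hβ => (key _ _).2 ((key' _ _).2 (by simpa using hβ)))
  · refine le_antisymm (le_of_forall_pt fun β hβ => ?_) ((pt_le_extend_iff hg hs).2 le_rfl)
    have h1 := (pt_le_iff _ (g.symm β).isAtom).1 ((key _ _).1 hβ)
    have h2 := (hs _ _).1 h1
    rw [g.apply_symm_apply] at h2
    exact h2.le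

/-- A bijection of antiflags preserving commutation comes from an isomorphism or an
anti-isomorphism of the lattices. -/
theorem exists_orderIso_or_antiIso [IsModularLattice L] [IsModularLattice L']
    {g : Antiflag L ≃ Antiflag L'} (hg : ∀ α β, Comm (g α) (g β) ↔ Comm α β) :
    (∃ Φ : L ≃o L', ∀ α, Φ α.pt = (g α).pt) ∨
      ∃ Φ : L ≃o L'ᵒᵈ, ∀ α, Φ α.pt = OrderDual.toDual (g α).hyp := by
  have hS : ∀ α β, Share (g α) (g β) ↔ Share α β := fun α β => share_map hg
  refine (straight_all_or hS).imp (exists_orderIso hg hS) fun hs => ?_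
  exact exists_orderIso (g := g.trans (dual L')) (fun α β => comm_dual.trans (hg α β))
    (fun α β => share_dual.trans (hS α β)) hs

end Antiflag

/-! ### The fundamental theorem of projective geometry -/

section FundamentalTheorem

open Submodule

variable {K V K' V' : Type*} [DivisionRing K] [AddCommGroup V] [Module K V]
  [DivisionRing K'] [AddCommGroup V'] [Module K' V']

lemma exists_sub_smul_mem_of_isCoatom {H : Submodule K V} (hH : IsCoatom H) {e : V} (he : e ∉ H)
    (v : V) : ∃ a : K, v - a • e ∈ H := by
  have h := (isCompl_span_singleton_of_isCoatom_of_notMem hH he).sup_eq_top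
  obtain ⟨y, hy, z, hz, rfl⟩ := mem_sup.1 (h ▸ mem_top : v ∈ H ⊔ span K {e})
  obtain ⟨a, rfl⟩ := mem_span_singleton.1 hz
  exact ⟨a, by simpa using hy⟩

lemma eq_zero_of_smul_mem {H : Submodule K V} {e : V} (he : e ∉ H) {a : K} (h : a • e ∈ H) :
    a = 0 := by
  by_contra ha
  exact he ((H.smul_mem_iff ha).1 h)

/-- The point at infinity of the affine line through `e + x` and `e + y`. -/
lemma span_sub_eq {H : Submodule K V} {e x y : V} (he : e ∉ H) (hx : x ∈ H) (hy : y ∈ H) :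
    span K {x - y} = (span K {e + x} ⊔ span K {e + y}) ⊓ H := by
  apply le_antisymm
  · rw [span_singleton_le_iff_mem]
    refine ⟨?_, sub_mem hx hy⟩
    have : x - y = (e + x) - (e + y) := by abel
    rw [this]
    exact sub_mem (mem_sup_left (mem_span_singleton_self _))
      (mem_sup_right (mem_span_singleton_self _))
  · rintro v ⟨hv, hvH⟩
    obtain ⟨u, hu, w, hw, rfl⟩ := mem_sup.1 hv
    obtain ⟨a, rfl⟩ := mem_span_singleton.1 hu
    obtain ⟨b, rfl⟩ := mem_span_singleton.1 hw
    have h1 : (a + b) • e ∈ H := by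
      have : (a + b) • e = (a • (e + x) + b • (e + y)) - (a • x + b • y) := by
        rw [add_smul, smul_add, smul_add]; abel
      rw [this]
      exact sub_mem hvH (add_mem (H.smul_mem _ hx) (H.smul_mem _ hy))
    have h2 : b = -a := eq_neg_of_add_eq_zero_right (eq_zero_of_smul_mem he h1)
    refine mem_span_singleton.2 ⟨a, ?_⟩
    rw [h2, smul_sub, smul_add, neg_smul, smul_add]; abel

lemma span_singleton_add_eq_iff {H : Submodule K V} {e x y : V} (he : e ∉ H) (hx : x ∈ H)
    (hy : y ∈ H) : span K {e + x} = span K {e + y} ↔ x = y := by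
  refine ⟨fun h => ?_, fun h => h ▸ rfl⟩
  have h1 := span_sub_eq he hx hy
  rw [h, sup_idem, ← sup_idem (span K {e + y}), ← span_sub_eq he hy hy, sub_self,
    span_zero_singleton, span_singleton_eq_bot] at h1
  exact sub_eq_zero.1 h1

/-- An isomorphism of subspace lattices carries the affine space `e + H` to the affine space
`e' + Φ H`. -/
lemma exists_map_add (Φ : Submodule K V ≃o Submodule K' V') {H : Submodule K V}
    (hH : IsCoatom H) {e : V} {e' : V'} (he : e ∉ H) (he' : e' ∉ Φ H) {x : V} (hx : x ∈ H) :
    ∃ y ∈ Φ H, Φ (span K {e + x}) = span K' {e' + y} := by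
  have h0 : e + x ≠ 0 := fun h => he (by
    rw [eq_neg_of_add_eq_zero_left h]; exact neg_mem hx)
  have h1 : IsAtom (Φ (span K {e + x})) := (Φ.isAtom_iff _).2 (nonzero_span_atom _ h0)
  obtain ⟨w, -, hw⟩ := (atom_iff_nonzero_span _).1 h1
  have hwH : w ∉ Φ H := fun h => by
    rw [← span_singleton_le_iff_mem, ← hw, Φ.le_iff_le, span_singleton_le_iff_mem] at h
    exact he ((Submodule.add_mem_iff_left _ hx).1 h)
  obtain ⟨a, ha⟩ := exists_sub_smul_mem_of_isCoatom ((Φ.isCoatom_iff _).2 hH) he' w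
  have ha0 : a ≠ 0 := by
    rintro rfl; exact hwH (by simpa using ha)
  refine ⟨a⁻¹ • (w - a • e'), smul_mem _ _ ha, ?_⟩
  rw [hw, smul_sub, inv_smul_smul₀ ha0, add_sub_cancel,
    span_singleton_smul_eq (IsUnit.mk0 _ (inv_ne_zero ha0))]

/-- A map between hyperplanes compatible with the directions of differences is additive. -/
lemma map_add_of_span_sub (Φ : Submodule K V ≃o Submodule K' V') {H : Submodule K V} {τ : V → V'}
    (hτ : ∀ x ∈ H, ∀ y ∈ H, Φ (span K {x - y}) = span K' {τ x - τ y}) (h0 : τ 0 = 0)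
    (hH : ∀ x ∈ H, ∃ z ∈ H, z ∉ span K {x}) {x y : V} (hx : x ∈ H) (hy : y ∈ H) :
    τ (x + y) = τ x + τ y := by
  have hspan : ∀ x ∈ H, Φ (span K {x}) = span K' {τ x} := fun x hx => by
    simpa [h0] using hτ x hx 0 H.zero_mem
  have key : ∀ x ∈ H, ∀ y ∈ H, y ∉ span K {x} → τ (x + y) = τ x + τ y := by
    intro x hx y hy hxy
    have h1 := hτ (x + y) (add_mem hx hy) y hy
    have h2 := hτ (x + y) (add_mem hx hy) x hx
    rw [add_sub_cancel_right, hspan x hx] at h1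
    rw [add_sub_cancel_left, hspan y hy] at h2
    obtain ⟨a, ha⟩ := mem_span_singleton.1 (h1 ▸ mem_span_singleton_self _ :
      τ (x + y) - τ y ∈ span K' {τ x})
    obtain ⟨b, hb⟩ := mem_span_singleton.1 (h2 ▸ mem_span_singleton_self _ :
      τ (x + y) - τ x ∈ span K' {τ y})
    have h3 : (b - 1) • τ y = (a - 1) • τ x := by
      rw [sub_smul, sub_smul, ha, hb, one_smul, one_smul]; abel
    have h4 : b - 1 = 0 := by
      by_contra hb0
      refine hxy ?_
      rw [← span_singleton_le_iff_mem, ← Φ.le_iff_le, hspan x hx, hspan y hy,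
        span_singleton_le_iff_mem, ← (Submodule.smul_mem_iff _ hb0), h3]
      exact smul_mem _ _ (mem_span_singleton_self _)
    rw [sub_eq_zero.1 h4, one_smul] at hb
    rw [hb]; abel
  by_cases hxy : y ∈ span K {x}
  · -- Compare the two ways of adding a vector independent of `x`.
    obtain ⟨z, hz, hzx⟩ := hH x hx
    have hle : ∀ w ∈ span K {x}, z ∉ span K {w} := fun w hw h =>
      hzx ((span_singleton_le_iff_mem _ _).2 hw h)
    have h1 := key x hx (y + z) (add_mem hy hz) fun h => hzx ((add_mem_cancel_left hxy).1 h)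
    have h2 := key (x + y) (add_mem hx hy) z hz
      (hle _ (add_mem (mem_span_singleton_self _) hxy))
    rw [key y hy z hz (hle _ hxy), ← add_assoc, h2, ← add_assoc] at h1
    exact add_right_cancel h1
  · exact key x hx y hy hxy

/-- An additive map between hyperplanes preserving lines is homogeneous. -/
lemma exists_map_smul (Φ : Submodule K V ≃o Submodule K' V') {H : Submodule K V} {τ : V → V'}
    (hspan : ∀ x ∈ H, Φ (span K {x}) = span K' {τ x})
    (hadd : ∀ x ∈ H, ∀ y ∈ H, τ (x + y) = τ x + τ y)
    (hH : ∀ x ∈ H, ∃ z ∈ H, z ∉ span K {x}) :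
    ∃ σ : K → K', ∀ (a : K), ∀ x ∈ H, τ (a • x) = σ a • τ x := by
  have h1 : ∀ a : K, ∀ x ∈ H, ∃ b : K', τ (a • x) = b • τ x := fun a x hx => by
    have : span K' {τ (a • x)} ≤ span K' {τ x} := by
      rw [← hspan x hx, ← hspan _ (H.smul_mem a hx), Φ.le_iff_le, span_singleton_le_iff_mem]
      exact smul_mem _ _ (mem_span_singleton_self _)
    obtain ⟨b, hb⟩ := mem_span_singleton.1 ((span_singleton_le_iff_mem _ _).1 this)
    exact ⟨b, hb.symm⟩
  have h00 : τ 0 = 0 := by simpa using hadd 0 H.zero_mem 0 H.zero_mem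
  have h2 : ∀ (a : K) (b : K'), ∀ x ∈ H, x ≠ 0 → ∀ y ∈ H, y ∉ span K {x} →
      τ (a • x) = b • τ x → τ (a • y) = b • τ y := by
    intro a b x hx hx0 y hy hxy hb
    obtain ⟨c, hc⟩ := h1 a y hy
    obtain ⟨d, hd⟩ := h1 a (x + y) (add_mem hx hy)
    rw [smul_add, hadd _ (H.smul_mem a hx) _ (H.smul_mem a hy), hadd x hx y hy, hb, hc] at hd
    have h3 : (c - d) • τ y = (d - b) • τ x := by
      rw [smul_add] at hd
      rw [sub_smul, sub_smul, sub_eq_sub_iff_add_eq_add, add_comm, hd, add_comm]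
    have h4 : c - d = 0 := by
      by_contra h0
      refine hxy ?_
      rw [← span_singleton_le_iff_mem, ← Φ.le_iff_le, hspan x hx, hspan y hy,
        span_singleton_le_iff_mem, ← (Submodule.smul_mem_iff _ h0), h3]
      exact smul_mem _ _ (mem_span_singleton_self _)
    rw [h4, zero_smul] at h3
    rcases smul_eq_zero.1 h3.symm with h5 | h5
    · rw [hc, sub_eq_zero.1 h4, sub_eq_zero.1 h5]
    · have h6 := hspan x hx
      rw [h5, span_zero_singleton, map_eq_bot_iff, span_singleton_eq_bot] at h6
      exact absurd h6 hx0
  obtain ⟨x, hx, hx0⟩ := hH 0 H.zero_mem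
  rw [span_zero_singleton, mem_bot] at hx0
  choose σ hσ using fun a => h1 a x hx
  refine ⟨σ, fun a y hy => ?_⟩
  by_cases hy0 : y = 0
  · rw [hy0, smul_zero, h00, smul_zero]
  by_cases hyx : y ∈ span K {x}
  · obtain ⟨z, hz, hzx⟩ := hH x hx
    refine h2 a _ z hz (fun h => hzx (h ▸ zero_mem _)) y hy (fun h => hzx ?_)
      (h2 a _ x hx hx0 z hz hzx (hσ a))
    obtain ⟨c, rfl⟩ := mem_span_singleton.1 h
    exact (smul_mem_iff _ (fun hc => hy0 (by rw [hc, zero_smul]))).1 hyx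
  · exact h2 a _ x hx hx0 y hy hyx (hσ a)

lemma finrank_of_isCoatom [FiniteDimensional K V] {H : Submodule K V} (hH : IsCoatom H) :
    Module.finrank K H + 1 = Module.finrank K V := by
  obtain ⟨e, -, he⟩ := SetLike.exists_of_lt hH.lt_top
  have h := isCompl_span_singleton_of_isCoatom_of_notMem hH he
  rw [← finrank_add_eq_of_isCompl h, finrank_span_singleton]
  rintro rfl; exact he H.zero_mem

/-- **Fundamental theorem of projective geometry**: an isomorphism between the lattices of
subspaces of two vector spaces, the first of finite dimension at least three, is induced by a
semilinear bijection. A hyperplane `H` and a vector `e ∉ H` are fixed; the points off `H` are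
the `⟨e + x⟩` with `x ∈ H`, and the resulting map `τ` of affine spaces is semilinear because it
respects directions. -/
theorem exists_semilinear_of_orderIso [FiniteDimensional K V] (hV : 3 ≤ Module.finrank K V)
    (Φ : Submodule K V ≃o Submodule K' V') :
    ∃ (σ : K ≃+* K') (l : V →ₛₗ[(σ : K →+* K')] V'), Function.Bijective l ∧
      ∀ W, Φ W = W.map l := by
  have : Nontrivial V := Module.nontrivial_of_finrank_pos (R := K) (by omega)
  obtain ⟨H, hHc, -⟩ := (eq_top_or_exists_le_coatom (⊥ : Submodule K V)).resolve_left bot_ne_top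
  obtain ⟨e, -, he⟩ := SetLike.exists_of_lt hHc.lt_top
  have he0 : e ≠ 0 := by rintro rfl; exact he H.zero_mem
  obtain ⟨e', -, hΦe⟩ := (atom_iff_nonzero_span _).1
    ((Φ.isAtom_iff _).2 (nonzero_span_atom e he0))
  have he' : e' ∉ Φ H := fun h => he (by
    rwa [← span_singleton_le_iff_mem, ← Φ.le_iff_le, hΦe, span_singleton_le_iff_mem])
  have hH : ∀ x ∈ H, ∃ z ∈ H, z ∉ span K {x} := by
    intro x hx
    by_contra! h
    have h1 : Module.finrank K H ≤ 1 :=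
      (Submodule.finrank_mono h).trans
        ((finrank_span_le_card ({x} : Set V)).trans (by simp))
    have := finrank_of_isCoatom hHc
    omega
  choose! τ hτH hτ using fun x hx => exists_map_add Φ hHc he he' (x := x) hx
  have hτ0 : τ 0 = 0 := by
    have h := hτ 0 H.zero_mem
    rw [add_zero, hΦe] at h
    refine ((span_singleton_add_eq_iff he' (hτH 0 H.zero_mem) (zero_mem _)).1 ?_)
    rw [← h, add_zero]
  have hsub : ∀ x ∈ H, ∀ y ∈ H, Φ (span K {x - y}) = span K' {τ x - τ y} := fun x hx y hy => by
    rw [span_sub_eq he hx hy, span_sub_eq he' (hτH x hx) (hτH y hy), Φ.map_inf, Φ.map_sup,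
      hτ x hx, hτ y hy]
  have hspan : ∀ x ∈ H, Φ (span K {x}) = span K' {τ x} := fun x hx => by
    simpa [hτ0] using hsub x hx 0 H.zero_mem
  have hadd : ∀ x ∈ H, ∀ y ∈ H, τ (x + y) = τ x + τ y := fun x hx y hy =>
    map_add_of_span_sub Φ hsub hτ0 hH hx hy
  obtain ⟨σ, hσ⟩ := exists_map_smul Φ hspan hadd hH
  have hinj : ∀ x ∈ H, τ x = 0 → x = 0 := fun x hx h => by
    have h1 := hspan x hx
    rwa [h, span_zero_singleton, map_eq_bot_iff, span_singleton_eq_bot] at h1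
  have hsurj : ∀ y ∈ Φ H, ∃ x ∈ H, τ x = y := fun y hy => by
    obtain ⟨x, hx, h⟩ := exists_map_add Φ.symm (H := Φ H) ((Φ.isCoatom_iff _).2 hHc)
      he' (by rwa [Φ.symm_apply_apply]) hy
    rw [Φ.symm_apply_apply] at hx
    refine ⟨x, hx, (span_singleton_add_eq_iff he' (hτH x hx) hy).1 ?_⟩
    rw [← hτ x hx, ← h, Φ.apply_symm_apply]
  obtain ⟨u, hu, hu0⟩ := hH 0 H.zero_mem
  rw [span_zero_singleton, mem_bot] at hu0
  have hτu : τ u ≠ 0 := fun h => hu0 (hinj u hu h)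
  have hcancel : ∀ a b : K', a • τ u = b • τ u → a = b := fun a b h => smul_left_injective _ hτu h
  let ρ : K →+* K' :=
    { toFun := σ
      map_one' := hcancel _ _ (by rw [← hσ 1 u hu, one_smul, one_smul])
      map_mul' := fun a b => hcancel _ _ (by
        rw [← hσ _ u hu, mul_smul, hσ _ _ (H.smul_mem b hu), hσ _ u hu, mul_smul])
      map_zero' := hcancel _ _ (by rw [← hσ 0 u hu, zero_smul, zero_smul, hτ0])
      map_add' := fun a b => hcancel _ _ (by
        rw [← hσ _ u hu, add_smul, hadd _ (H.smul_mem a hu) _ (H.smul_mem b hu), hσ _ u hu,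
          hσ _ u hu, add_smul]) }
  have hρ : Function.Bijective ρ := by
    refine ⟨ρ.injective, fun c => ?_⟩
    obtain ⟨x, hx, hxc⟩ := hsurj (c • τ u) (smul_mem _ _ (hτH u hu))
    have h1 : x ∈ span K {u} := by
      rw [← span_singleton_le_iff_mem, ← Φ.le_iff_le, hspan x hx, hspan u hu, hxc,
        span_singleton_le_iff_mem]
      exact smul_mem _ _ (mem_span_singleton_self _)
    obtain ⟨a, rfl⟩ := mem_span_singleton.1 h1
    exact ⟨a, hcancel _ _ (by rw [← hxc, hσ a u hu]; rfl)⟩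
  -- The functional `coef` with kernel `H` taking the value one at `e`.
  choose coef hcoef using exists_sub_smul_mem_of_isCoatom hHc he
  have hcoef_eq : ∀ v a, v - a • e ∈ H → coef v = a := fun v a h => by
    refine (sub_eq_zero.1 (eq_zero_of_smul_mem he (a := a - coef v) ?_)).symm
    have : (a - coef v) • e = (v - coef v • e) - (v - a • e) := by rw [sub_smul]; abel
    rw [this]
    exact sub_mem (hcoef v) h
  have hcoef_add : ∀ v w, coef (v + w) = coef v + coef w := fun v w => hcoef_eq _ _ (by
    have : v + w - (coef v + coef w) • e = (v - coef v • e) + (w - coef w • e) := by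
      rw [add_smul]; abel
    rw [this]
    exact add_mem (hcoef v) (hcoef w))
  have hcoef_smul : ∀ (a : K) v, coef (a • v) = a * coef v := fun a v => hcoef_eq _ _ (by
    rw [mul_smul, ← smul_sub]
    exact H.smul_mem a (hcoef v))
  let σ' : K ≃+* K' := RingEquiv.ofBijective ρ hρ
  let l : V →ₛₗ[(σ' : K →+* K')] V' :=
    { toFun := fun v => σ (coef v) • e' + τ (v - coef v • e)
      map_add' := fun v w => by
        have h1 : v + w - (coef v + coef w) • e = (v - coef v • e) + (w - coef w • e) := by
          rw [add_smul]; abel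
        have h2 : σ (coef v + coef w) = σ (coef v) + σ (coef w) := ρ.map_add _ _
        rw [hcoef_add, h1, hadd _ (hcoef v) _ (hcoef w), h2, add_smul]
        abel
      map_smul' := fun a v => by
        have h2 : σ (a * coef v) = σ a * σ (coef v) := ρ.map_mul _ _
        rw [hcoef_smul, mul_smul, ← smul_sub, hσ _ _ (hcoef v), h2, mul_smul, ← smul_add]
        rfl }
  have hl : ∀ v, l v = σ (coef v) • e' + τ (v - coef v • e) := fun v => rfl
  have hlspan : ∀ v, Φ (span K {v}) = span K' {l v} := fun v => by
    by_cases hv : coef v = 0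
    · have h1 := hcoef v
      rw [hv, zero_smul, sub_zero] at h1
      have h2 : σ 0 = 0 := ρ.map_zero
      rw [hl, hv, h2, zero_smul, zero_smul, sub_zero, zero_add, hspan v h1]
    · have h3 : σ (coef v) ≠ 0 := (map_ne_zero ρ).2 hv
      have h4 : σ (coef v)⁻¹ = (σ (coef v))⁻¹ := map_inv₀ ρ _
      have h5 := hτ _ (H.smul_mem (coef v)⁻¹ (hcoef v))
      rw [hσ _ _ (hcoef v), h4] at h5
      rw [← span_singleton_smul_eq (IsUnit.mk0 _ (inv_ne_zero hv)) v,
        ← span_singleton_smul_eq (IsUnit.mk0 _ (inv_ne_zero h3)) (l v), hl, smul_add,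
        inv_smul_smul₀ h3, ← h5, smul_sub, inv_smul_smul₀ hv, add_sub_cancel]
  refine ⟨σ', l, ⟨?_, ?_⟩, fun W => ?_⟩
  · rw [injective_iff_map_eq_zero]
    intro v hv
    have h1 := hlspan v
    rwa [hv, span_zero_singleton, map_eq_bot_iff, span_singleton_eq_bot] at h1
  · intro w
    obtain ⟨c, hc⟩ := exists_sub_smul_mem_of_isCoatom ((Φ.isCoatom_iff _).2 hHc) he' w
    obtain ⟨a, rfl⟩ := hρ.2 c
    obtain ⟨x, hx, hxw⟩ := hsurj _ hc
    refine ⟨a • e + x, ?_⟩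
    have h1 : coef (a • e + x) = a := hcoef_eq _ _ (by rwa [add_sub_cancel_left])
    rw [hl, h1, add_sub_cancel_left, hxw]
    exact add_sub_cancel _ _
  · apply le_antisymm
    · intro w hw
      by_cases hw0 : w = 0
      · rw [hw0]; exact zero_mem _
      obtain ⟨v, -, hv⟩ := (atom_iff_nonzero_span _).1
        ((Φ.symm.isAtom_iff _).2 (nonzero_span_atom w hw0))
      have h1 : span K' {w} = span K' {l v} := by
        rw [← hlspan, ← hv, Φ.apply_symm_apply]
      have h2 : v ∈ W := by
        rwa [← span_singleton_le_iff_mem, ← hv, ← Φ.le_iff_le, Φ.apply_symm_apply,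
          span_singleton_le_iff_mem]
      rw [← span_singleton_le_iff_mem, h1, span_singleton_le_iff_mem]
      exact mem_map_of_mem h2
    · rintro _ ⟨v, hv, rfl⟩
      rw [← span_singleton_le_iff_mem, ← hlspan, Φ.le_iff_le, span_singleton_le_iff_mem]
      exact hv

end FundamentalTheorem

/-! ### Coordinate subspaces -/

section CoordSpan

open Submodule

variable {R V ι : Type*} [DivisionRing R] [AddCommGroup V] [Module R V]

/-- The coordinate subspace spanned by the basis vectors with indices in `I`. -/
def coordSpan (b : Module.Basis ι R V) (I : Set ι) : Submodule R V := span R (b '' I)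

variable {b c : Module.Basis ι R V} {I J : Set ι}

lemma mem_coordSpan {v : V} : v ∈ coordSpan b I ↔ ∀ i ∉ I, b.repr v i = 0 := by
  rw [coordSpan, b.mem_span_image]
  refine ⟨fun h i hi => ?_, fun h i hi => ?_⟩
  · by_contra h0
    exact hi (h (by simpa using h0))
  · by_contra h0
    exact (by simpa using hi : b.repr v i ≠ 0) (h i h0)

@[simp]
lemma basis_mem_coordSpan {i : ι} : b i ∈ coordSpan b I ↔ i ∈ I := by
  rw [mem_coordSpan]
  refine ⟨fun h => ?_, fun h j hj => ?_⟩
  · by_contra hi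
    simpa using h i hi
  · rw [b.repr_self, Finsupp.single_eq_of_ne]
    rintro rfl; exact hj h

lemma coordSpan_le {W : Submodule R V} : coordSpan b I ≤ W ↔ ∀ i ∈ I, b i ∈ W := by
  simp [coordSpan, span_le, Set.subset_def]

@[simp]
lemma coordSpan_le_coordSpan : coordSpan b I ≤ coordSpan b J ↔ I ⊆ J := by
  simp [coordSpan_le, Set.subset_def]

lemma coordSpan_injective (b : Module.Basis ι R V) : Function.Injective (coordSpan b) :=
  fun _ _ h => (coordSpan_le_coordSpan.1 h.le).antisymm (coordSpan_le_coordSpan.1 h.ge)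

lemma coordSpan_singleton (b : Module.Basis ι R V) (i : ι) : coordSpan b {i} = span R {b i} := by
  simp [coordSpan]

@[simp]
lemma coordSpan_univ (b : Module.Basis ι R V) : coordSpan b Set.univ = ⊤ := by
  simp [coordSpan, b.span_eq]

@[simp]
lemma coordSpan_empty (b : Module.Basis ι R V) : coordSpan b ∅ = ⊥ := by
  simp [coordSpan]

lemma coordSpan_union (b : Module.Basis ι R V) (I J : Set ι) :
    coordSpan b (I ∪ J) = coordSpan b I ⊔ coordSpan b J := by
  rw [coordSpan, Set.image_union, span_union]; rfl

lemma coordSpan_inter (b : Module.Basis ι R V) (I J : Set ι) :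
    coordSpan b (I ∩ J) = coordSpan b I ⊓ coordSpan b J := by
  ext v
  simp only [mem_inf, mem_coordSpan, Set.mem_inter_iff, not_and_or]
  grind

lemma coordSpan_eq_iSup (b : Module.Basis ι R V) (I : Set ι) :
    coordSpan b I = ⨆ i : I, coordSpan b {(i : ι)} := by
  apply le_antisymm
  · exact coordSpan_le.2 fun i hi => mem_iSup_of_mem ⟨i, hi⟩ (by simp)
  · exact iSup_le fun i => by simp

lemma mem_coordSpan_of_singleton_le {i : ι} {W : Submodule R V} (h : coordSpan b {i} ≤ W) :
    b i ∈ W := h (by simp)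

lemma coordSpan_eq_image {κ : Type*} {c : Module.Basis κ R V} {τ : ι → κ}
    (h : ∀ i, coordSpan b {i} = coordSpan c {τ i}) (I : Set ι) :
    coordSpan b I = coordSpan c (τ '' I) := by
  apply le_antisymm
  · refine coordSpan_le.2 fun i hi => mem_coordSpan_of_singleton_le ((h i).le.trans ?_)
    simpa using ⟨i, hi, rfl⟩
  · refine coordSpan_le.2 ?_
    rintro _ ⟨i, hi, rfl⟩
    refine mem_coordSpan_of_singleton_le ((h i).ge.trans ?_)
    simpa using hi

/-- An intersection of coordinate subspaces is a coordinate subspace. -/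
lemma sInf_eq_coordSpan {X : Set (Submodule R V)} (h : ∀ W ∈ X, ∃ J, W = coordSpan b J) :
    sInf X = coordSpan b {i | ∀ W ∈ X, b i ∈ W} := by
  ext v
  rw [mem_sInf, mem_coordSpan]
  constructor
  · intro hv i hi
    simp only [Set.mem_ofPred_eq, not_forall] at hi
    obtain ⟨W, hW, hiW⟩ := hi
    obtain ⟨J, rfl⟩ := h W hW
    exact mem_coordSpan.1 (hv _ hW) i (by simpa using hiW)
  · intro hv W hW
    obtain ⟨J, rfl⟩ := h W hW
    exact mem_coordSpan.2 fun i hi => hv i fun h' => hi (by simpa using h' _ hW)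

lemma coordSpan_reindex {κ : Type*} (b : Module.Basis ι R V) (e : ι ≃ κ) (I : Set κ) :
    coordSpan (b.reindex e) I = coordSpan b (e ⁻¹' I) := by
  rw [coordSpan, coordSpan, ← e.image_symm_eq_preimage, Set.image_image]
  simp

lemma isCompl_coordSpan (b : Module.Basis ι R V) (I : Set ι) :
    IsCompl (coordSpan b I) (coordSpan b Iᶜ) := by
  constructor
  · rw [disjoint_iff, ← coordSpan_inter, Set.inter_compl_self, coordSpan_empty]
  · rw [codisjoint_iff, ← coordSpan_union, Set.union_compl_self, coordSpan_univ]

lemma isAtom_coordSpan_singleton (b : Module.Basis ι R V) (i : ι) :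
    IsAtom (coordSpan b {i}) := by
  rw [coordSpan_singleton]
  exact nonzero_span_atom _ (b.ne_zero i)

lemma isCoatom_coordSpan_compl (b : Module.Basis ι R V) (i : ι) :
    IsCoatom (coordSpan b {i}ᶜ) :=
  (isCompl_coordSpan b {i}).isAtom_iff_isCoatom.1 (isAtom_coordSpan_singleton b i)

lemma finrank_coordSpan [Finite ι] (b : Module.Basis ι R V) (I : Set ι) :
    Module.finrank R (coordSpan b I) = I.ncard := by
  classical
  have := Fintype.ofFinite ι
  have h := finrank_span_set_eq_card (R := R) (s := b '' I)
    (b.linearIndependent.linearIndepOn_id.mono (Set.image_subset_range _ _))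
  rw [coordSpan, h, ← Set.ncard_eq_toFinset_card', Set.ncard_image_of_injective _ b.injective]

lemma coordSpan_eq_of_forall_mem [Finite ι] (h : ∀ i ∈ I, c i ∈ coordSpan b I) :
    coordSpan b I = coordSpan c I := by
  have := Module.Finite.of_basis b
  exact (eq_of_le_of_finrank_eq (coordSpan_le.2 h)
    (by rw [finrank_coordSpan, finrank_coordSpan])).symm

/-- Complementary subspaces are coordinate subspaces for a common basis. -/
lemma exists_basis_of_isCompl [FiniteDimensional R V] {S U : Submodule R V} (h : IsCompl S U) :
    ∃ (b : Module.Basis (Fin (Module.finrank R V)) R V) (I : Set (Fin (Module.finrank R V))),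
      S = coordSpan b I ∧ U = coordSpan b Iᶜ := by
  let b' := ((Module.finBasis R S).prod (Module.finBasis R U)).map (prodEquivOfIsCompl S U h)
  have hcard : Fintype.card (Fin (Module.finrank R S) ⊕ Fin (Module.finrank R U)) =
      Fintype.card (Fin (Module.finrank R V)) := by
    simp [finrank_add_eq_of_isCompl h]
  let e := Fintype.equivOfCardEq hcard
  have hS : coordSpan b' (Set.range Sum.inl) ≤ S := coordSpan_le.2 (by
    rintro _ ⟨i, rfl⟩
    simp [b', Module.Basis.prod_apply])
  have hU : coordSpan b' (Set.range Sum.inr) ≤ U := coordSpan_le.2 (by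
    rintro _ ⟨i, rfl⟩
    simp [b', Module.Basis.prod_apply])
  refine ⟨b'.reindex e, e '' Set.range Sum.inl, ?_, ?_⟩
  · rw [coordSpan_reindex, e.preimage_image]
    refine (eq_of_le_of_finrank_eq hS ?_).symm
    rw [finrank_coordSpan, ← Set.image_univ, Set.ncard_image_of_injective _ Sum.inl_injective]
    simp
  · rw [coordSpan_reindex, ← Set.image_compl_eq e.bijective, e.preimage_image,
      Set.compl_range_inl]
    refine (eq_of_le_of_finrank_eq hU ?_).symm
    rw [finrank_coordSpan, ← Set.image_univ, Set.ncard_image_of_injective _ Sum.inr_injective]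
    simp

/-- A basis vector may be exchanged for any vector with nonzero coordinate. -/
lemma exists_basis_update [Finite ι] (b : Module.Basis ι R V) {r : ι} {v : V}
    (hv : b.repr v r ≠ 0) :
    ∃ c : Module.Basis ι R V, c r = v ∧ ∀ l, l ≠ r → c l = b l := by
  classical
  have := Fintype.ofFinite ι
  have htop : ⊤ ≤ span R (Set.range (Function.update b r v)) := by
    have hl : ∀ l, l ≠ r → b l ∈ span R (Set.range (Function.update b r v)) := fun l hl =>
      subset_span ⟨l, by simp [hl]⟩
    have hr : b r ∈ span R (Set.range (Function.update b r v)) := by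
      rw [← smul_mem_iff _ hv]
      have h1 : b.repr v r • b r = v - ∑ l ∈ Finset.univ.erase r, b.repr v l • b l := by
        rw [eq_sub_iff_add_eq, Finset.add_sum_erase _ (fun l => b.repr v l • b l)
          (Finset.mem_univ r), b.sum_repr]
      rw [h1]
      exact sub_mem (subset_span ⟨r, by simp⟩) (sum_mem fun l hl' =>
        smul_mem _ _ (hl l (Finset.ne_of_mem_erase hl')))
    rw [← b.span_eq, span_le]
    rintro _ ⟨l, rfl⟩
    by_cases h : l = r
    · exact h ▸ hr
    · exact hl l h
  refine ⟨basisOfTopLeSpanOfCardEqFinrank _ htop (Module.finrank_eq_card_basis b).symm, ?_, ?_⟩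
  · simp
  · intro l hl; simp [hl]

/-- The bases `b` and `c` differ only in the plane of the basis vectors with indices `i`, `j`:
coordinate subspaces containing both of them or none of them coincide. -/
def AdjAt (i j : ι) (b c : Module.Basis ι R V) : Prop :=
  ∀ I : Set ι, (i ∈ I ↔ j ∈ I) → coordSpan b I = coordSpan c I

lemma adjAt_of_mem [Finite ι] {i j : ι} (h : ∀ l, l ≠ i → c l = b l)
    (hi : c i ∈ coordSpan b {i, j}) : AdjAt i j b c := by
  intro I hI
  refine coordSpan_eq_of_forall_mem fun l hl => ?_
  by_cases hli : l = i
  · subst hli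
    refine coordSpan_le_coordSpan.2 ?_ hi
    rintro _ (rfl | rfl)
    exacts [hl, hI.1 hl]
  · rw [h l hli]; simpa using hl

end CoordSpan

/-! ### Separating sets -/

section Separation

variable {ι : Type*} [Fintype ι] {k : ℕ}

/-- There is a `k`-set containing four given elements and avoiding four given ones. -/
lemma exists_separating (hι : Fintype.card ι = 2 * k) (hk : 4 ≤ k) (x₁ x₂ x₃ x₄ y₁ y₂ y₃ y₄ : ι)
    (h : ∀ x ∈ [x₁, x₂, x₃, x₄], ∀ y ∈ [y₁, y₂, y₃, y₄], x ≠ y) :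
    ∃ I : Set ι, I.ncard = k ∧ (∀ x ∈ [x₁, x₂, x₃, x₄], x ∈ I) ∧
      ∀ y ∈ [y₁, y₂, y₃, y₄], y ∉ I := by
  classical
  have hsub : ({x₁, x₂, x₃, x₄} : Finset ι) ⊆ ({y₁, y₂, y₃, y₄} : Finset ι)ᶜ := by
    intro x hx
    simp only [Finset.mem_insert, Finset.mem_singleton, Finset.mem_compl] at hx ⊢
    intro hy
    exact h x (by simpa using hx) x (by simpa using hy) rfl
  have h1 : ({x₁, x₂, x₃, x₄} : Finset ι).card ≤ k := Finset.card_le_four.trans hk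
  have h2 : k ≤ (({y₁, y₂, y₃, y₄} : Finset ι)ᶜ).card := by
    have : ({y₁, y₂, y₃, y₄} : Finset ι).card ≤ 4 := Finset.card_le_four
    rw [Finset.card_compl, hι]
    omega
  obtain ⟨I, hI1, hI2, hI⟩ := Finset.exists_subsuperset_card_eq hsub h1 h2
  refine ⟨I, by rw [Set.ncard_coe_finset, hI], fun x hx => ?_, fun y hy hyI => ?_⟩
  · exact hI1 (by simpa using hx)
  · exact Finset.mem_compl.1 (hI2 hyI) (by simpa using hy)

/-- If every `k`-set separating neither `a, b` nor `c, d` does not separate `e, f`, then the pair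
`{e, f}` is one of the other two pairs or completes them to a triangle. -/
lemma pair_of_forall_not_separated (hι : Fintype.card ι = 2 * k) (hk : 4 ≤ k)
    {a b c d e f : ι} (hab : a ≠ b) (hcd : c ≠ d) (hef : e ≠ f)
    (h : ∀ I : Set ι, I.ncard = k → (a ∈ I ↔ b ∈ I) → (c ∈ I ↔ d ∈ I) → (e ∈ I ↔ f ∈ I)) :
    s(e, f) = s(a, b) ∨ s(e, f) = s(c, d) ∨
      ∃ x y z, s(a, b) = s(x, y) ∧ s(c, d) = s(x, z) ∧ s(e, f) = s(y, z) := by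
  have key : ∀ x₁ x₂ x₃ x₄ y₁ y₂ y₃ y₄ : ι,
      (∀ x ∈ [x₁, x₂, x₃, x₄], ∀ y ∈ [y₁, y₂, y₃, y₄], x ≠ y) →
      ∃ I : Set ι, ((a ∈ I ↔ b ∈ I) → (c ∈ I ↔ d ∈ I) → (e ∈ I ↔ f ∈ I)) ∧
      (∀ x ∈ [x₁, x₂, x₃, x₄], x ∈ I) ∧ ∀ y ∈ [y₁, y₂, y₃, y₄], y ∉ I := fun _ _ _ _ _ _ _ _ hxy =>
    let ⟨I, h1, h2⟩ := exists_separating hι hk _ _ _ _ _ _ _ _ hxy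
    ⟨I, h I h1, h2⟩
  by_contra hcon
  simp only [List.mem_cons, List.not_mem_nil, or_false] at key
  rw [not_or, not_or] at hcon
  obtain ⟨h1, h2, h3⟩ := hcon
  rw [Sym2.eq_iff] at h1 h2
  have h3' : ∀ x y z, s(a, b) = s(x, y) → s(c, d) = s(x, z) → s(e, f) ≠ s(y, z) :=
    fun x y z hx hy hz => h3 ⟨x, y, z, hx, hy, hz⟩
  simp only [Sym2.eq_iff, ne_eq] at h3'
  by_cases hshare : a = c ∨ a = d ∨ b = c ∨ b = d
  · by_cases he : e = a ∨ e = b ∨ e = c ∨ e = d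
    · obtain ⟨I, h4, h5, h6⟩ := key a b c d f f f f (by
        have := h3' a b d
        have := h3' b a d
        have := h3' a b c
        have := h3' b a c
        grind)
      grind
    · by_cases hf : f = a ∨ f = b ∨ f = c ∨ f = d
      · obtain ⟨I, h4, h5, h6⟩ := key a b c d e e e e (by grind)
        grind
      · clear h3'
        rcases hshare with rfl | rfl | rfl | rfl
        · obtain ⟨I, h4, h5, h6⟩ := key e e e e f a b d (by grind)
          grind
        · obtain ⟨I, h4, h5, h6⟩ := key e e e e f a b c (by grind)
          grind
        · obtain ⟨I, h4, h5, h6⟩ := key e e e e f a b d (by grind)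
          grind
        · obtain ⟨I, h4, h5, h6⟩ := key e e e e f a b c (by grind)
          grind
  · clear h3'
    by_cases he : e = a ∨ e = b
    · obtain ⟨I, h4, h5, h6⟩ := key a a a b f f c d (by grind)
      grind
    · by_cases he' : e = c ∨ e = d
      · obtain ⟨I, h4, h5, h6⟩ := key c c c d f f a b (by grind)
        grind
      · by_cases hf : f = a ∨ f = b
        · obtain ⟨I, h4, h5, h6⟩ := key e e c d a a b f (by grind)
          grind
        · obtain ⟨I, h4, h5, h6⟩ := key e e a b c c d f (by grind)
          grind

/-- A pair of indices is determined by the `k`-sets not separating it. -/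
lemma pair_eq_of_forall_not_separated (hι : Fintype.card ι = 2 * k) (hk : 4 ≤ k)
    {a b e f : ι} (hab : a ≠ b) (hef : e ≠ f)
    (h : ∀ I : Set ι, I.ncard = k → (a ∈ I ↔ b ∈ I) → (e ∈ I ↔ f ∈ I)) : s(e, f) = s(a, b) := by
  rcases pair_of_forall_not_separated hι hk hab hab hef fun I hI h1 _ => h I hI h1 with
    h1 | h1 | ⟨x, y, z, h1, h2, h3⟩
  · exact h1
  · exact h1
  · rw [h1, Sym2.congr_right] at h2
    rw [Sym2.eq_iff] at h3
    grind

variable {T : Type*} {cut cut' : T → Set ι}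

/-- Suppose that the `k`-subsets of an index set are parametrized in two ways, so that the members
not separating a given pair are, in the second parametrization, those not separating some other
pair. Then the correspondence of pairs comes from a permutation of the indices. -/
lemma exists_perm_of_pairs (hι : Fintype.card ι = 2 * k) (hk : 4 ≤ k)
    (hcut : ∀ I : Set ι, I.ncard = k ↔ ∃ t, cut t = I)
    (hcut' : ∀ I : Set ι, I.ncard = k ↔ ∃ t, cut' t = I)
    (h : ∀ i j, i ≠ j → ∃ i' j', i' ≠ j' ∧
      ∀ t, (i ∈ cut t ↔ j ∈ cut t) ↔ (i' ∈ cut' t ↔ j' ∈ cut' t)) :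
    ∃ π : Equiv.Perm ι, ∀ i j t, (i ∈ cut t ↔ j ∈ cut t) ↔ (π i ∈ cut' t ↔ π j ∈ cut' t) := by
  classical
  choose! u v huv hS using h
  have hcutk : ∀ t, (cut t).ncard = k := fun t => (hcut _).2 ⟨t, rfl⟩
  -- Triangles of pairs are mapped to triangles, and only triangles are.
  have tri : ∀ i j l, i ≠ j → i ≠ l → j ≠ l → ∃ x y z,
      s(u i j, v i j) = s(x, y) ∧ s(u i l, v i l) = s(x, z) ∧ s(u j l, v j l) = s(y, z) := by
    intro i j l hij hil hjl
    have hne : ∀ {a b c d : ι}, a ≠ b → c ≠ d → s(a, b) ≠ s(c, d) →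
        s(u a b, v a b) ≠ s(u c d, v c d) := by
      intro a b c d hab hcd hne heq
      refine hne (pair_eq_of_forall_not_separated hι hk hcd hab fun I hI h1 => ?_)
      obtain ⟨t, rfl⟩ := (hcut I).1 hI
      rw [hS a b hab]
      rw [hS c d hcd] at h1
      rw [Sym2.eq_iff] at heq
      grind
    rcases pair_of_forall_not_separated hι hk (huv i j hij) (huv i l hil) (huv j l hjl)
      (fun I hI h1 h2 => by
        obtain ⟨t, rfl⟩ := (hcut' I).1 hI
        rw [← hS i j hij] at h1
        rw [← hS i l hil] at h2
        rw [← hS j l hjl, ← h1, h2]) with h1 | h1 | h1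
    · refine absurd h1 (hne hjl hij ?_)
      rw [ne_eq, Sym2.eq_iff]; grind
    · refine absurd h1 (hne hjl hil ?_)
      rw [ne_eq, Sym2.eq_iff]; grind
    · exact h1
  have not_tri : ∀ i j l m, i ≠ j → i ≠ l → i ≠ m → j ≠ l → j ≠ m → l ≠ m → ∀ x y z,
      s(u i j, v i j) = s(x, y) → s(u i l, v i l) = s(x, z) → s(u i m, v i m) ≠ s(y, z) := by
    intro i j l m hij hil him hjl hjm hlm x y z h1 h2 h3
    have h4 := pair_of_forall_not_separated hι hk hij hil him (fun I hI h4 h5 => by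
      obtain ⟨t, rfl⟩ := (hcut I).1 hI
      rw [hS i j hij] at h4
      rw [hS i l hil] at h5
      rw [hS i m him]
      simp only [Sym2.eq_iff] at h1 h2 h3
      grind)
    simp only [Sym2.eq_iff] at h4
    grind
  have hsymm : ∀ i j, i ≠ j → s(u i j, v i j) = s(u j i, v j i) := by
    intro i j hij
    refine pair_eq_of_forall_not_separated hι hk (huv j i hij.symm) (huv i j hij)
      fun I hI h1 => ?_
    obtain ⟨t, rfl⟩ := (hcut' I).1 hI
    rw [← hS j i hij.symm] at h1
    rw [← hS i j hij, h1]
  have hthird : ∀ i j : ι, ∃ l, i ≠ l ∧ j ≠ l := fun i j => by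
    have h1 : ({i, j} : Finset ι).card < Fintype.card ι :=
      Finset.card_le_two.trans_lt (by omega)
    obtain ⟨l, hl⟩ := Finset.exists_mem_notMem_of_card_lt_card (t := Finset.univ) h1
    exact ⟨l, by simp at hl; grind, by simp at hl; grind⟩
  -- The pairs containing `i` are mapped to pairs with a common element.
  have hcommon : ∀ i, ∃ x, ∀ j, i ≠ j → x = u i j ∨ x = v i j := by
    intro i
    obtain ⟨j, hij, -⟩ := hthird i i
    obtain ⟨l, hil, hjl⟩ := hthird i j
    obtain ⟨x, y, z, h1, h2, h3⟩ := tri i j l hij hil hjl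
    refine ⟨x, fun m him => ?_⟩
    by_cases hjm : j = m
    · subst hjm; rw [Sym2.eq_iff] at h1; grind
    by_cases hlm : l = m
    · subst hlm; rw [Sym2.eq_iff] at h2; grind
    have h4 := not_tri i j l m hij hil him hjl hjm hlm x y z h1 h2
    obtain ⟨x₁, y₁, z₁, h5, h6, -⟩ := tri i j m hij him hjm
    obtain ⟨x₂, y₂, z₂, h7, h8, -⟩ := tri i l m hil him hlm
    have := huv j l hjl
    simp only [ne_eq, Sym2.eq_iff] at *
    grind
  choose π hπ using hcommon
  have hinj : Function.Injective π := by
    intro i i' heq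
    by_contra hne
    obtain ⟨j, hij, hij'⟩ := hthird i i'
    obtain ⟨x, y, z, h1, h2, h3⟩ := tri i i' j hne hij hij'
    have h4 := hπ i i' hne
    have h5 := hπ i j hij
    have h6 := hπ i' j hij'
    have h7 := huv i i' hne
    have h8 := huv i j hij
    have h9 := huv i' j hij'
    rw [Sym2.eq_iff] at h1 h2 h3
    grind
  refine ⟨Equiv.ofBijective π (Finite.injective_iff_bijective.1 hinj), fun i j t => ?_⟩
  simp only [Equiv.ofBijective_apply]
  by_cases hij : i = j
  · subst hij; simp
  have h1 := hπ i j hij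
  have h2 := hπ j i (Ne.symm hij)
  have h3 := hsymm i j hij
  have h4 := hinj.ne hij
  rw [hS i j hij t]
  rw [Sym2.eq_iff] at h3
  grind

end Separation

/-! ### Base subsets and the permutations of indices attached to them -/

/-- A basis of `V`, indexed as in the definition of base subsets. -/
abbrev Frame (R V : Type*) [DivisionRing R] [AddCommGroup V] [Module R V] :=
  Module.Basis (Fin (Module.finrank R V)) R V

namespace GrassPair

open Submodule Module

variable {R V : Type*} [DivisionRing R] [AddCommGroup V] [Module R V] {k : ℕ}
  {b c b' c' : Frame R V} {I J : Set (Fin (finrank R V))} {α β : GrassPair R V k}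

/-- `α` is the element of the base subset of `b` given by the index set `I`. -/
def IsCoord (b : Frame R V) (I : Set (Fin (finrank R V))) (α : GrassPair R V k) : Prop :=
  α.fst = coordSpan b I ∧ α.snd = coordSpan b Iᶜ

lemma IsCoord.eq (h : IsCoord b I α) (h' : IsCoord b I β) : α = β :=
  GrassPair.ext (h.1.trans h'.1.symm) (h.2.trans h'.2.symm)

lemma IsCoord.ncard (h : IsCoord b I α) : I.ncard = k := by
  rw [← finrank_coordSpan b, ← h.1, α.finrank_fst]

lemma IsCoord.mem_iff (h : IsCoord b I α) {i : Fin (finrank R V)} : b i ∈ α.fst ↔ i ∈ I := by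
  rw [h.1, basis_mem_coordSpan]

lemma exists_isCoord (b : Frame R V) (hI : I.ncard = k) : ∃ α : GrassPair R V k, IsCoord b I α :=
  ⟨⟨coordSpan b I, coordSpan b Iᶜ, by rw [finrank_coordSpan, hI],
    by rw [finrank_coordSpan, Set.ncard_compl, hI, Nat.card_fin],
    (isCompl_coordSpan b I).sup_eq_top⟩, rfl, rfl⟩

lemma isCompl [FiniteDimensional R V] (α : GrassPair R V k) : IsCompl α.fst α.snd := by
  refine ⟨?_, codisjoint_iff.2 α.sup_eq_top⟩
  have h1 := finrank_sup_add_finrank_inf_eq α.fst α.snd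
  have h2 := finrank_le α.fst
  rw [α.sup_eq_top, finrank_top, α.finrank_snd, α.finrank_fst] at h1
  rw [α.finrank_fst] at h2
  rw [disjoint_iff, ← finrank_eq_zero (R := R)]
  omega

lemma mem_baseSubset_iff [FiniteDimensional R V] :
    α ∈ baseSubset k b ↔ ∃ I, IsCoord b I α := by
  refine ⟨?_, fun ⟨I, h1, h2⟩ => ⟨⟨I, h1⟩, ⟨Iᶜ, h2⟩⟩⟩
  rintro ⟨⟨I, hI : α.fst = coordSpan b I⟩, ⟨J, hJ : α.snd = coordSpan b J⟩⟩
  refine ⟨I, hI, ?_⟩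
  have h := α.isCompl
  rw [hI, hJ] at h
  have h1 : I ∩ J = ∅ := coordSpan_injective b (by
    rw [coordSpan_inter, h.inf_eq_bot, coordSpan_empty])
  have h2 : I ∪ J = Set.univ := coordSpan_injective b (by
    rw [coordSpan_union, h.sup_eq_top, coordSpan_univ])
  rw [hJ]
  congr 1
  ext i
  have h3 := Set.ext_iff.1 h1 i
  have h4 := Set.ext_iff.1 h2 i
  simp only [Set.mem_inter_iff, Set.mem_empty_iff_false, Set.mem_union, Set.mem_univ] at h3 h4
  rw [Set.mem_compl_iff]
  tauto

lemma mem_baseSubset_of_eq (h : α ∈ baseSubset k b) (hb : ∀ I, ∃ J, coordSpan b I = coordSpan c J) :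
    α ∈ baseSubset k c := by
  obtain ⟨⟨I, hI⟩, ⟨J, hJ⟩⟩ := h
  obtain ⟨I', hI'⟩ := hb I
  obtain ⟨J', hJ'⟩ := hb J
  exact ⟨⟨I', hI.trans hI'⟩, ⟨J', hJ.trans hJ'⟩⟩

lemma exists_mem_baseSubset [FiniteDimensional R V] (α : GrassPair R V k) :
    ∃ (b : Frame R V) (I : _), IsCoord b I α :=
  exists_basis_of_isCompl α.isCompl

/-- If elements common to two base subsets separate the index `l` from all other indices, then
the `l`-th coordinate line of the first basis is a coordinate line of the second one. -/
lemma exists_line_eq {A : Set (GrassPair R V k)} (hb : A ⊆ baseSubset k b)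
    (hc : A ⊆ baseSubset k c) {l : Fin (finrank R V)} [FiniteDimensional R V]
    (h : ∀ m, m ≠ l → ∃ α ∈ A, ¬(b l ∈ α.fst ↔ b m ∈ α.fst)) :
    ∃ m, coordSpan b {l} = coordSpan c {m} := by
  let X : Set (Submodule R V) := {W | b l ∈ W ∧ ∃ α ∈ A, W = α.fst ∨ W = α.snd}
  have hXb : ∀ W ∈ X, ∃ J, W = coordSpan b J := by
    rintro W ⟨-, α, hα, rfl | rfl⟩
    exacts [(hb hα).1, (hb hα).2]
  have hXc : ∀ W ∈ X, ∃ J, W = coordSpan c J := by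
    rintro W ⟨-, α, hα, rfl | rfl⟩
    exacts [(hc hα).1, (hc hα).2]
  have h1 : {i | ∀ W ∈ X, b i ∈ W} = {l} := by
    ext m
    rw [Set.mem_ofPred_eq, Set.mem_singleton_iff]
    refine ⟨fun hm => ?_, fun hm W hW => hm ▸ hW.1⟩
    by_contra hml
    obtain ⟨α, hα, hsep⟩ := h m hml
    obtain ⟨I, hI⟩ := mem_baseSubset_iff.1 (hb hα)
    rw [hI.mem_iff, hI.mem_iff] at hsep
    by_cases hl : l ∈ I
    · have := hm α.fst ⟨hI.mem_iff.2 hl, α, hα, Or.inl rfl⟩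
      rw [hI.mem_iff] at this
      exact hsep (iff_of_true hl this)
    · have := hm α.snd ⟨by rw [hI.2, basis_mem_coordSpan]; exact hl, α, hα, Or.inr rfl⟩
      rw [hI.2, basis_mem_coordSpan] at this
      exact hsep (iff_of_false hl this)
  have h2 := (sInf_eq_coordSpan hXb).symm.trans (sInf_eq_coordSpan hXc)
  rw [h1] at h2
  have h3 := congrArg (fun W : Submodule R V => finrank R W) h2
  simp only [finrank_coordSpan, Set.ncard_singleton] at h3
  obtain ⟨m, hm⟩ := Set.ncard_eq_one.1 h3.symm
  exact ⟨m, h2.trans (by rw [hm])⟩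

/-- A set contained in two base subsets fails to separate some pair of indices. -/
lemma exists_pair_of_subset [FiniteDimensional R V] {A : Set (GrassPair R V k)}
    (hb : A ⊆ baseSubset k b) (hc : A ⊆ baseSubset k c) (hne : baseSubset k b ≠ baseSubset k c) :
    ∃ i j, i ≠ j ∧ ∀ α ∈ A, (b i ∈ α.fst ↔ b j ∈ α.fst) := by
  by_contra! hcon
  refine hne ?_
  choose τ hτ using fun l => exists_line_eq hb hc (l := l) fun m hm => by
    obtain ⟨α, hα, h⟩ := hcon l m hm.symm
    exact ⟨α, hα, by tauto⟩
  have hinj : Function.Injective τ := fun l m hlm => by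
    have h := hτ l
    rw [hlm, ← hτ m] at h
    simpa using coordSpan_injective b h
  have hsurj := Finite.injective_iff_surjective.1 hinj
  have himage := coordSpan_eq_image hτ
  ext α
  refine ⟨fun h => mem_baseSubset_of_eq h fun I => ⟨_, himage I⟩,
    fun h => mem_baseSubset_of_eq h fun I => ⟨τ ⁻¹' I, ?_⟩⟩
  rw [himage, Set.image_preimage_eq _ hsurj]

/-- Conversely, the elements of a base subset not separating a given pair lie in a second base
subset: the one obtained by replacing `b i` by `b i + b j`. -/
lemma exists_baseSubset_ne (hn : finrank R V = 2 * k) (hk : 4 ≤ k) (b : Frame R V)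
    {i j : Fin (finrank R V)} (hij : i ≠ j) :
    ∃ c : Frame R V, baseSubset k b ≠ baseSubset k c ∧
      ∀ α ∈ baseSubset k b, (b i ∈ α.fst ↔ b j ∈ α.fst) → α ∈ baseSubset k c := by
  have : FiniteDimensional R V := Module.Finite.of_basis b
  obtain ⟨c, hci, hc⟩ := exists_basis_update b (r := i) (v := b i + b j) (by
    simp [Finsupp.single_eq_of_ne hij])
  have hadj : AdjAt i j b c := adjAt_of_mem hc (by
    rw [hci]; exact add_mem (by simp) (by simp))
  refine ⟨c, fun heq => ?_, fun α hα h => ?_⟩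
  · obtain ⟨I, hI, hiI, hjI⟩ := exists_separating (by simpa using hn) hk i i i i j j j j
      (by simpa using hij)
    obtain ⟨α, hα⟩ := exists_isCoord c hI
    have hαb : α ∈ baseSubset k b := heq ▸ mem_baseSubset_iff.2 ⟨I, hα⟩
    obtain ⟨J, hJ⟩ := mem_baseSubset_iff.1 hαb
    have h1 : b i + b j ∈ coordSpan b J := by
      rw [← hJ.1, ← hci, hα.mem_iff]; exact hiI i (by simp)
    have h2 : j ∈ J := by
      by_contra hj
      have := mem_coordSpan.1 h1 j hj
      simp [Finsupp.single_eq_of_ne hij.symm] at this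
    rw [← hJ.mem_iff, ← hc j hij.symm, hα.mem_iff] at h2
    exact hjI j (by simp) h2
  · obtain ⟨I, hI⟩ := mem_baseSubset_iff.1 hα
    rw [hI.mem_iff, hI.mem_iff] at h
    exact mem_baseSubset_iff.2 ⟨I, hI.1.trans (hadj I h),
      hI.2.trans (hadj Iᶜ (not_congr h))⟩

/-- `f` maps the base subset of `b` to that of `c`, respecting index sets up to complements. -/
def Transports (f : Equiv.Perm (GrassPair R V k)) (b c : Frame R V) : Prop :=
  ∀ I α, IsCoord b I α → IsCoord c I (f α) ∨ IsCoord c Iᶜ (f α)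

/-- Non-separation of a pair of indices is carried by `f` to non-separation of some pair, because
`f` respects being contained in a second base subset. -/
lemma exists_pair_map [FiniteDimensional R V] (hn : finrank R V = 2 * k) (hk : 4 ≤ k)
    {f : Equiv.Perm (GrassPair R V k)} (hf : f ∈ baseGroup R V k)
    (hfb : f '' baseSubset k b = baseSubset k c) {i j : Fin (finrank R V)} (hij : i ≠ j) :
    ∃ i' j', i' ≠ j' ∧ ∀ α ∈ baseSubset k b, (b i ∈ α.fst ↔ b j ∈ α.fst) →
      (c i' ∈ (f α).fst ↔ c j' ∈ (f α).fst) := by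
  obtain ⟨d, hd, hd'⟩ := exists_baseSubset_ne hn hk b hij
  obtain ⟨d', hfd⟩ := (hf _).2 ⟨d, rfl⟩
  obtain ⟨i', j', hij', h⟩ := exists_pair_of_subset
    (A := f '' {α | α ∈ baseSubset k b ∧ (b i ∈ α.fst ↔ b j ∈ α.fst)}) (b := c) (c := d')
    (by rw [← hfb]; exact Set.image_mono fun α hα => hα.1)
    (by rw [← hfd]; exact Set.image_mono fun α hα => hd' α hα.1 hα.2)
    (by rw [← hfb, ← hfd]; exact fun h => hd (f.injective.image_injective h))
  exact ⟨i', j', hij', fun α hα h1 => h _ ⟨α, ⟨hα, h1⟩, rfl⟩⟩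

/-- A transformation preserving the class of base subsets carries every basis to a basis, once the
vectors of the latter are numbered suitably. -/
lemma exists_transports [FiniteDimensional R V] (hn : finrank R V = 2 * k) (hk : 4 ≤ k)
    {f : Equiv.Perm (GrassPair R V k)} (hf : f ∈ baseGroup R V k) (b : Frame R V) :
    ∃ c, Transports f b c := by
  obtain ⟨c, hfb⟩ := (hf _).2 ⟨b, rfl⟩
  have hι : Fintype.card (Fin (finrank R V)) = 2 * k := by simpa using hn
  have hfb' : f.symm '' baseSubset k c = baseSubset k b := by
    rw [← hfb, ← Set.image_comp]; simp
  have hmem : ∀ α ∈ baseSubset k b, f α ∈ baseSubset k c := fun α hα => hfb ▸ ⟨α, hα, rfl⟩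
  obtain ⟨π, hπ⟩ := exists_perm_of_pairs (T := baseSubset k b) (k := k) hι hk
    (cut := fun α => {i | b i ∈ α.1.fst}) (cut' := fun α => {i | c i ∈ (f α.1).fst})
    (fun I => ⟨fun hI => by
      obtain ⟨α, hα⟩ := exists_isCoord b hI
      exact ⟨⟨α, mem_baseSubset_iff.2 ⟨I, hα⟩⟩, Set.ext fun i => hα.mem_iff⟩, by
      rintro ⟨⟨α, hα⟩, rfl⟩
      obtain ⟨I, hI⟩ := mem_baseSubset_iff.1 hα
      exact (congrArg _ (Set.ext fun i => hI.mem_iff)).trans hI.ncard⟩)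
    (fun I => ⟨fun hI => by
      obtain ⟨α, hα⟩ := exists_isCoord c hI
      have h1 : α ∈ f '' baseSubset k b := hfb ▸ mem_baseSubset_iff.2 ⟨I, hα⟩
      obtain ⟨β, hβ, rfl⟩ := h1
      exact ⟨⟨β, hβ⟩, Set.ext fun i => hα.mem_iff⟩, by
      rintro ⟨⟨α, hα⟩, rfl⟩
      obtain ⟨I, hI⟩ := mem_baseSubset_iff.1 (hmem α hα)
      exact (congrArg _ (Set.ext fun i => hI.mem_iff)).trans hI.ncard⟩)
    (fun i j hij => by
      obtain ⟨i', j', hij', h⟩ := exists_pair_map hn hk hf hfb hij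
      obtain ⟨i'', j'', hij'', h'⟩ := exists_pair_map hn hk (inv_mem hf) hfb' hij'
      -- Going to `c` and back, the pair `{i, j}` is recovered.
      have heq : s(i'', j'') = s(i, j) := by
        refine pair_eq_of_forall_not_separated hι hk hij hij'' fun I hI h1 => ?_
        obtain ⟨α, hα⟩ := exists_isCoord b hI
        have hαb := mem_baseSubset_iff.2 ⟨I, hα⟩
        have h2 := h' (f α) (hmem α hαb) (h α hαb (by rwa [hα.mem_iff, hα.mem_iff]))
        change (b i'' ∈ (f.symm (f α)).fst ↔ b j'' ∈ (f.symm (f α)).fst) at h2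
        rwa [f.symm_apply_apply, hα.mem_iff, hα.mem_iff] at h2
      refine ⟨i', j', hij', fun α => ⟨h α α.2, fun h1 => ?_⟩⟩
      have h2 := h' (f α) (hmem α α.2) h1
      change (b i'' ∈ (f.symm (f α)).fst ↔ b j'' ∈ (f.symm (f α)).fst) at h2
      rw [f.symm_apply_apply] at h2
      simp only [Set.mem_ofPred_eq]
      rw [Sym2.eq_iff] at heq
      grind)
  refine ⟨c.reindex π.symm, fun I α hα => ?_⟩
  have hαb := mem_baseSubset_iff.2 ⟨I, hα⟩
  obtain ⟨J, hJ⟩ := mem_baseSubset_iff.1 (hmem α hαb)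
  have h1 : ∀ i j, (i ∈ I ↔ j ∈ I) ↔ (π i ∈ J ↔ π j ∈ J) := fun i j => by
    have := hπ i j ⟨α, hαb⟩
    simpa only [Set.mem_ofPred_eq, hα.mem_iff, hJ.mem_iff] using this
  have h2 : J = π.symm ⁻¹' I ∨ J = π.symm ⁻¹' Iᶜ := by
    have h3 : ∀ i, ∀ j, (π.symm i ∈ I ↔ π.symm j ∈ I) ↔ (i ∈ J ↔ j ∈ J) := fun i j => by
      simpa using h1 (π.symm i) (π.symm j)
    by_cases hcase : ∃ i, (i ∈ J ↔ π.symm i ∈ I)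
    · obtain ⟨i, hi⟩ := hcase
      left; ext j; have := h3 i j; simp only [Set.mem_preimage]; tauto
    · push Not at hcase
      right; ext j; have := hcase j; simp only [Set.mem_preimage, Set.mem_compl_iff]; tauto
  unfold IsCoord
  rw [coordSpan_reindex, coordSpan_reindex, coordSpan_reindex, compl_compl]
  rcases h2 with rfl | rfl
  · exact Or.inl hJ
  · exact Or.inr ⟨hJ.1, hJ.2.trans (by rw [← Set.preimage_compl, compl_compl])⟩

end GrassPair

/-! ### Moves between bases -/

section Moves

open Submodule

variable {R V ι : Type*} [DivisionRing R] [AddCommGroup V] [Module R V]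

/-- `c` arises from `b` by a change in a coordinate plane not involving the index `x`. -/
def Move (x : ι) (b c : Module.Basis ι R V) : Prop :=
  ∃ i j, i ≠ j ∧ i ≠ x ∧ j ≠ x ∧ AdjAt i j b c

lemma Move.reflTransGen_coordSpan {x : ι} {b c : Module.Basis ι R V}
    (h : Relation.ReflTransGen (Move x) b c) :
    coordSpan b {x} = coordSpan c {x} ∧ coordSpan b {x}ᶜ = coordSpan c {x}ᶜ := by
  induction h with
  | refl => exact ⟨rfl, rfl⟩
  | tail _ h ih =>
    obtain ⟨i, j, -, hi, hj, hadj⟩ := h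
    exact ⟨ih.1.trans (hadj _ (by simp [hi, hj])), ih.2.trans (hadj _ (by simp [hi, hj]))⟩

/-- By moves a basis vector may be changed by any combination of the others not involving the
`x`-th one. -/
lemma exists_moves_update [Fintype ι] {x r : ι} (b : Module.Basis ι R V) {w : V} (hr : b.repr w r = 1)
    (hx : b.repr w x = 0) :
    ∃ c, Relation.ReflTransGen (Move x) b c ∧ c r = w ∧ ∀ l, l ≠ r → c l = b l := by
  classical
  have hrx : r ≠ x := by rintro rfl; simp [hx] at hr
  have key : ∀ t : Finset ι, r ∉ t → x ∉ t → ∃ c : Module.Basis ι R V,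
      Relation.ReflTransGen (Move x) b c ∧ c r = b r + ∑ l ∈ t, b.repr w l • b l ∧
      ∀ l, l ≠ r → c l = b l := by
    intro t
    induction t using Finset.induction_on with
    | empty => exact fun _ _ => ⟨b, .refl, by simp, fun _ _ => rfl⟩
    | insert j t hj ih =>
      intro hrt hxt
      rw [Finset.mem_insert, not_or] at hrt hxt
      obtain ⟨c, hbc, hcr, hc⟩ := ih hrt.2 hxt.2
      obtain ⟨d, hdr, hd⟩ := exists_basis_update c (r := r) (v := c r + b.repr w j • c j) (by
        simp [Finsupp.single_eq_of_ne hrt.1])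
      refine ⟨d, hbc.tail ⟨r, j, hrt.1, hrx, Ne.symm hxt.1, adjAt_of_mem hd ?_⟩, ?_, ?_⟩
      · rw [hdr]
        exact add_mem (by simp) (smul_mem _ _ (by simp))
      · rw [hdr, hcr, hc j (Ne.symm hrt.1), Finset.sum_insert hj]
        abel
      · exact fun l hl => (hd l hl).trans (hc l hl)
  obtain ⟨c, h1, h2, h3⟩ := key ((Finset.univ.erase r).erase x) (by simp) (by simp)
  refine ⟨c, h1, ?_, h3⟩
  rw [h2]
  nth_rewrite 2 [← b.sum_repr w]
  rw [← Finset.add_sum_erase _ _ (Finset.mem_univ r), hr, one_smul,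
    ← Finset.add_sum_erase _ _ (Finset.mem_erase.2 ⟨hrx.symm, Finset.mem_univ x⟩), hx, zero_smul,
    zero_add]

lemma adjAt_reindex_swap [DecidableEq ι] (b : Module.Basis ι R V) (i j : ι) :
    AdjAt i j b (b.reindex (Equiv.swap i j)) := by
  intro I hI
  rw [coordSpan_reindex]
  congr 1
  ext l
  rw [Set.mem_preimage]
  by_cases h1 : l = i
  · subst h1; rw [Equiv.swap_apply_left, hI]
  · by_cases h2 : l = j
    · subst h2; rw [Equiv.swap_apply_right, hI]
    · rw [Equiv.swap_apply_of_ne_of_ne h1 h2]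

/-- Two bases with the same `x`-th coordinate line and the same complementary hyperplane are
joined by moves: the remaining lines are installed one after the other. -/
lemma exists_moves [Fintype ι] {x : ι} {b c : Module.Basis ι R V}
    (h : coordSpan b {x}ᶜ = coordSpan c {x}ᶜ) (s : Finset ι) (hs : x ∉ s) :
    ∃ d, Relation.ReflTransGen (Move x) b d ∧ ∀ l ∈ s, coordSpan d {l} = coordSpan c {l} := by
  classical
  induction s using Finset.induction_on with
  | empty => exact ⟨b, .refl, by simp⟩
  | insert r s hr ih =>
    rw [Finset.mem_insert, not_or] at hs
    obtain ⟨d, hbd, hd⟩ := ih hs.2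
    have hdx : coordSpan d {x}ᶜ = coordSpan c {x}ᶜ :=
      (Move.reflTransGen_coordSpan hbd).2.symm.trans h
    have hvx : d.repr (c r) x = 0 := by
      have : c r ∈ coordSpan d {x}ᶜ := by
        rw [hdx, basis_mem_coordSpan]
        exact Ne.symm hs.1
      exact mem_coordSpan.1 this x (by simp)
    obtain ⟨l, hls, hl⟩ : ∃ l ∉ s, d.repr (c r) l ≠ 0 := by
      by_contra! hcon
      have h1 : c r ∈ coordSpan d (s : Set ι) := mem_coordSpan.2 hcon
      have h2 : coordSpan d (s : Set ι) ≤ coordSpan c (s : Set ι) := coordSpan_le.2 fun i hi =>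
        mem_coordSpan_of_singleton_le ((hd i hi).le.trans (by simpa using hi))
      exact hr (by simpa using h2 h1)
    have hlx : l ≠ x := by rintro rfl; exact hl hvx
    -- Exchange the roles of `l` and `r` so that the `r`-th coordinate of `c r` is nonzero.
    obtain ⟨e, hde, he, her⟩ : ∃ e : Module.Basis ι R V, Relation.ReflTransGen (Move x) d e ∧
        (∀ m ∈ s, coordSpan e {m} = coordSpan d {m}) ∧ e.repr (c r) r ≠ 0 := by
      by_cases hlr : l = r
      · exact ⟨d, .refl, fun _ _ => rfl, hlr ▸ hl⟩
      · have hadj := adjAt_reindex_swap d l r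
        refine ⟨_, .single ⟨l, r, hlr, hlx, Ne.symm hs.1, hadj⟩, fun m hm => (hadj _ ?_).symm, ?_⟩
        · have h1 : l ≠ m := by rintro rfl; exact hls hm
          have h2 : r ≠ m := by rintro rfl; exact hr hm
          simp [h1, h2]
        · simpa using hl
    have hex : e.repr (c r) x = 0 := by
      have h1 : c r ∈ coordSpan e {x}ᶜ := by
        rw [← (Move.reflTransGen_coordSpan hde).2, hdx, basis_mem_coordSpan]
        exact Ne.symm hs.1
      exact mem_coordSpan.1 h1 x (by simp)
    obtain ⟨e', hee', hr', he'⟩ := exists_moves_update (x := x) (r := r) e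
      (w := (e.repr (c r) r)⁻¹ • c r) (by simp [her]) (by simp [hex])
    refine ⟨e', (hbd.trans hde).trans hee', fun m hm => ?_⟩
    rcases Finset.mem_insert.1 hm with rfl | hms
    · rw [coordSpan_singleton, coordSpan_singleton, hr',
        span_singleton_smul_eq (IsUnit.mk0 _ (inv_ne_zero her))]
    · have h2 : m ≠ r := by rintro rfl; exact hr hms
      rw [coordSpan_singleton, he' m h2, ← coordSpan_singleton, he m hms, hd m hms]

end Moves

/-! ### The transformation of antiflags induced by a transformation of `𝔊 k` -/

namespace GrassPair

open Submodule Module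

variable {R V : Type*} [DivisionRing R] [AddCommGroup V] [Module R V] {k : ℕ}
  {b c b' c' : Frame R V} {I J : Set (Fin (finrank R V))} {α β : GrassPair R V k}

lemma exists_index_ne (hn : finrank R V = 2 * k) (hk : 4 ≤ k) (a b c d : Fin (finrank R V)) :
    ∃ l, l ≠ a ∧ l ≠ b ∧ l ≠ c ∧ l ≠ d := by
  have h1 : ({a, b, c, d} : Finset (Fin (finrank R V))).card <
      (Finset.univ : Finset (Fin (finrank R V))).card :=
    Finset.card_le_four.trans_lt (by rw [Finset.card_fin]; omega)
  obtain ⟨l, -, hl⟩ := Finset.exists_mem_notMem_of_card_lt_card h1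
  simp only [Finset.mem_insert, Finset.mem_singleton, not_or] at hl
  exact ⟨l, hl⟩

lemma Transports.symm (hn : finrank R V = 2 * k) (hk : 4 ≤ k)
    {f : Equiv.Perm (GrassPair R V k)} (h : Transports f b c) : Transports f.symm c b := by
  intro I β hβ
  obtain ⟨α, hα⟩ := exists_isCoord (k := k) b hβ.ncard
  rcases h I α hα with h1 | h1
  · left; rwa [h1.eq hβ |>.symm, f.symm_apply_apply]
  · have hI : Iᶜ.ncard = k := h1.ncard
    obtain ⟨α', hα'⟩ := exists_isCoord (k := k) b hI
    rcases h _ α' hα' with h2 | h2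
    · have h3 := f.injective (h1.eq h2)
      have h4 := coordSpan_injective b (hα.1.symm.trans (h3 ▸ hα'.1))
      obtain ⟨i, -⟩ : ∃ i : Fin (finrank R V), True := ⟨⟨0, by omega⟩, trivial⟩
      have := Set.ext_iff.1 h4 i
      simp at this
    · rw [compl_compl] at h2
      right; rwa [h2.eq hβ |>.symm, f.symm_apply_apply]

lemma Transports.same_side_iff {f : Equiv.Perm (GrassPair R V k)} (h : Transports f b c)
    (hα : IsCoord b I α) (i j : Fin (finrank R V)) :
    (c i ∈ (f α).fst ↔ c j ∈ (f α).fst) ↔ (i ∈ I ↔ j ∈ I) := by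
  rcases h I α hα with h1 | h1 <;> rw [h1.mem_iff, h1.mem_iff]
  simp only [Set.mem_compl_iff]
  tauto

lemma IsCoord.congr (hI : coordSpan b I = coordSpan c I) (hI' : coordSpan b Iᶜ = coordSpan c Iᶜ)
    (h : IsCoord b I α) : IsCoord c I α := ⟨h.1.trans hI, h.2.trans hI'⟩

/-- If `b` and `c` differ in one coordinate plane, then so do the bases to which they are
transported, in the plane with the same indices; only the consequences for the lines with other
indices and for their complements are recorded. -/
lemma Transports.coordSpan_eq_of_adjAt [FiniteDimensional R V] (hn : finrank R V = 2 * k)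
    (hk : 4 ≤ k) {f : Equiv.Perm (GrassPair R V k)} (hb : Transports f b b')
    (hc : Transports f c c') {i j : Fin (finrank R V)} (hij : i ≠ j) (hadj : AdjAt i j b c)
    {l : Fin (finrank R V)} (hli : l ≠ i) (hlj : l ≠ j) :
    coordSpan b' {l} = coordSpan c' {l} ∧ coordSpan b' {l}ᶜ = coordSpan c' {l}ᶜ := by
  have hι : Fintype.card (Fin (finrank R V)) = 2 * k := by simpa using hn
  have hcoord : ∀ {I α}, (i ∈ I ↔ j ∈ I) → IsCoord (k := k) b I α → IsCoord c I α :=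
    fun h hα => hα.congr (hadj _ h) (hadj _ (not_congr h))
  have hmem : ∀ {b b' : Frame R V}, Transports f b b' → ∀ {I α}, IsCoord b I α →
      f α ∈ baseSubset k b' := fun h _ _ hα =>
    mem_baseSubset_iff.2 ((h _ _ hα).elim (fun h => ⟨_, h⟩) fun h => ⟨_, h⟩)
  let A : Set (GrassPair R V k) := {β | ∃ I α, (i ∈ I ↔ j ∈ I) ∧ IsCoord b I α ∧ β = f α}
  have hAb : A ⊆ baseSubset k b' := by
    rintro _ ⟨I, α, -, hα, rfl⟩
    exact hmem hb hα
  have hAc : A ⊆ baseSubset k c' := by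
    rintro _ ⟨I, α, h, hα, rfl⟩
    exact hmem hc (hcoord h hα)
  have hτ : ∀ l, l ≠ i → l ≠ j → ∃ m, coordSpan b' {l} = coordSpan c' {m} := by
    intro l hli hlj
    refine exists_line_eq hAb hAc fun m hm => ?_
    obtain ⟨I, hI, h1, h2⟩ := exists_separating hι hk l l l l m i j j (by
      simp [hm.symm, hli, hlj])
    simp only [List.mem_cons, List.not_mem_nil, or_false, forall_eq_or_imp, forall_eq] at h1 h2
    obtain ⟨α, hα⟩ := exists_isCoord b hI
    refine ⟨f α, ⟨I, α, iff_of_false h2.2.1 h2.2.2.1, hα, rfl⟩, ?_⟩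
    rw [hb.same_side_iff hα]
    tauto
  choose! τ hτ using hτ
  -- The index set of a line of `b'` in `c'` is found from the sets separating it from others.
  have hpair : ∀ l m, l ≠ i → l ≠ j → m ≠ i → m ≠ j → l ≠ m → s(l, m) = s(τ l, τ m) := by
    intro l m hli hlj hmi hmj hlm
    have hτlm : τ l ≠ τ m := fun h => hlm (by
      have h1 := hτ l hli hlj
      rw [h, ← hτ m hmi hmj] at h1
      simpa using coordSpan_injective b' h1)
    have h0 : ∀ I : Set (Fin (finrank R V)), I.ncard = k → (i ∈ I ↔ j ∈ I) →
        (τ l ∈ I ↔ τ m ∈ I) → (l ∈ I ↔ m ∈ I) := by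
      intro I hI h1 h2
      obtain ⟨α, hα⟩ := exists_isCoord b hI
      rw [← hc.same_side_iff (hcoord h1 hα)] at h2
      rw [← hb.same_side_iff hα]
      have h3 : ∀ l, l ≠ i → l ≠ j → (b' l ∈ (f α).fst ↔ c' (τ l) ∈ (f α).fst) := by
        intro l hli hlj
        rw [← span_singleton_le_iff_mem, ← span_singleton_le_iff_mem, ← coordSpan_singleton,
          ← coordSpan_singleton, hτ l hli hlj]
      rw [h3 l hli hlj, h3 m hmi hmj, h2]
    rcases pair_of_forall_not_separated hι hk hij hτlm hlm h0 with h1 | h1 | ⟨x, y, z, h1, -, h2⟩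
    · rw [Sym2.eq_iff] at h1; grind
    · exact h1
    · rw [Sym2.eq_iff] at h1 h2; grind
  have hline : ∀ l, l ≠ i → l ≠ j → coordSpan b' {l} = coordSpan c' {l} := by
    intro l hli hlj
    obtain ⟨m, hmi, hmj, hml, -⟩ := exists_index_ne hn hk i j l l
    obtain ⟨p, hpi, hpj, hpl, hpm⟩ := exists_index_ne hn hk i j l m
    have h1 := hpair l m hli hlj hmi hmj hml.symm
    have h2 := hpair l p hli hlj hpi hpj hpl.symm
    have h3 : τ l = l := by
      rw [Sym2.eq_iff] at h1 h2; grind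
    rw [hτ l hli hlj, h3]
  refine ⟨hline l hli hlj, coordSpan_eq_of_forall_mem fun m hm => ?_⟩
  obtain ⟨p, hpi, hpj, hpl, -⟩ := exists_index_ne hn hk i j l l
  obtain ⟨I, hI, h1, h2⟩ := exists_separating hι hk m p i j l l l l (by
    have hm' : m ≠ l := hm
    simp [hm', hli.symm, hlj.symm, hpl])
  simp only [List.mem_cons, List.not_mem_nil, or_false, forall_eq_or_imp, forall_eq] at h1 h2
  obtain ⟨α, hα⟩ := exists_isCoord b hI
  -- The common line with index `p` decides between `I` and its complement.
  have hp : ∀ J, coordSpan b' J = coordSpan c' Jᶜ → False := fun J h => by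
    have h3 : p ∈ J ↔ p ∈ Jᶜ := by
      rw [← basis_mem_coordSpan (b := b'), h, ← basis_mem_coordSpan (b := c'),
        ← span_singleton_le_iff_mem, ← span_singleton_le_iff_mem, ← coordSpan_singleton,
        ← coordSpan_singleton, hline p hpi hpj]
    simp at h3
  have heq : coordSpan b' I = coordSpan c' I := by
    rcases hb I α hα with h3 | h3 <;>
      rcases hc I α (hcoord (iff_of_true h1.2.2.1 h1.2.2.2) hα) with h4 | h4
    · exact h3.1.symm.trans h4.1
    · exact (hp _ (h3.1.symm.trans h4.1)).elim
    · exact (hp _ (h3.1.symm.trans (by rw [compl_compl]; exact h4.1))).elim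
    · have := h3.2.symm.trans h4.2
      rwa [compl_compl] at this
  have hle : coordSpan b' I ≤ coordSpan b' {l}ᶜ := coordSpan_le_coordSpan.2 (by
    simpa using h2.1)
  apply hle
  rw [heq, basis_mem_coordSpan]
  exact h1.1

/-- The images of the `x`-th line and of the complementary hyperplane depend only on this line
and this hyperplane, not on the other lines of the basis. -/
lemma Transports.coordSpan_eq [FiniteDimensional R V] (hn : finrank R V = 2 * k)
    (hk : 4 ≤ k) {f : Equiv.Perm (GrassPair R V k)} (hf : f ∈ baseGroup R V k)
    (hb : Transports f b b') (hc : Transports f c c') {x y : Fin (finrank R V)}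
    (h₁ : coordSpan b {x} = coordSpan c {y}) (h₂ : coordSpan b {x}ᶜ = coordSpan c {y}ᶜ) :
    coordSpan b' {x} = coordSpan c' {y} ∧ coordSpan b' {x}ᶜ = coordSpan c' {y}ᶜ := by
  have key : ∀ d, Relation.ReflTransGen (Move x) b d → ∀ d', Transports f d d' →
      coordSpan b' {x} = coordSpan d' {x} ∧ coordSpan b' {x}ᶜ = coordSpan d' {x}ᶜ := by
    intro d hd
    induction hd with
    | refl =>
      intro d' hd'
      obtain ⟨i, hix, -⟩ := exists_index_ne hn hk x x x x
      obtain ⟨j, hjx, hji, -⟩ := exists_index_ne hn hk x i x x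
      exact hb.coordSpan_eq_of_adjAt hn hk hd' hji (fun _ _ => rfl) hjx.symm hix.symm
    | tail _ hm ih =>
      intro d' hd'
      obtain ⟨i, j, hij, hix, hjx, hadj⟩ := hm
      obtain ⟨e', he'⟩ := exists_transports hn hk hf _
      have h1 := ih e' he'
      have h2 := he'.coordSpan_eq_of_adjAt hn hk hd' hij hadj hix.symm hjx.symm
      exact ⟨h1.1.trans h2.1, h1.2.trans h2.2⟩
  -- Renumber `c` so that the two lines have the same index.
  let e := Equiv.swap x y
  have he : ∀ d : Frame R V, coordSpan (d.reindex e) {x} = coordSpan d {y} ∧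
      coordSpan (d.reindex e) {x}ᶜ = coordSpan d {y}ᶜ := by
    intro d
    have h1 : e ⁻¹' {x} = {y} := by
      ext i; simp [e, Equiv.swap_apply_eq_iff]
    rw [coordSpan_reindex, coordSpan_reindex, Set.preimage_compl, h1]
    exact ⟨rfl, rfl⟩
  have hce : Transports f (c.reindex e) (c'.reindex e) := by
    intro I α hα
    have h1 := hc (e ⁻¹' I) α
    simp only [IsCoord, coordSpan_reindex, Set.preimage_compl] at hα h1 ⊢
    exact h1 hα
  obtain ⟨d, hbd, hd⟩ := exists_moves (x := x) (b := b) (c := c.reindex e)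
    (h₂.trans (he c).2.symm) (Finset.univ.erase x) (by simp)
  have hdc : ∀ i, coordSpan d {i} = coordSpan (c.reindex e) {i} := by
    intro i
    by_cases hi : i = x
    · rw [hi, ← (Move.reflTransGen_coordSpan hbd).1, h₁, (he c).1]
    · exact hd i (by simp [hi])
  have hdc' : ∀ I, coordSpan d I = coordSpan (c.reindex e) I := fun I => by
    simpa using coordSpan_eq_image (τ := id) hdc I
  have hdt : Transports f d (c'.reindex e) := fun I α hα =>
    hce I α (hα.congr (hdc' _) (hdc' _))
  have h3 := key d hbd _ hdt
  exact ⟨h3.1.trans (he c').1, h3.2.trans (he c').2⟩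

end GrassPair

/-! ### Antiflags of a vector space -/

open Submodule Module in
/-- The subspaces of a space of dimension at least three form a projective lattice. -/
lemma Submodule.projectiveLattice {R V : Type*} [DivisionRing R] [AddCommGroup V] [Module R V]
    [FiniteDimensional R V] (hV : 3 ≤ finrank R V) : ProjectiveLattice (Submodule R V) where
  exists_atom {x a b} ha hb := by
    obtain ⟨v, hvx, hva⟩ := SetLike.not_le_iff_exists.1 ha
    obtain ⟨w, hwx, hwb⟩ := SetLike.not_le_iff_exists.1 hb
    obtain ⟨u, hux, hua, hub⟩ : ∃ u ∈ x, u ∉ a ∧ u ∉ b := by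
      by_cases hvb : v ∈ b
      · by_cases hwa : w ∈ a
        · exact ⟨v + w, add_mem hvx hwx, fun h => hva ((add_mem_cancel_right hwa).1 h),
            fun h => hwb ((add_mem_cancel_left hvb).1 h)⟩
        · exact ⟨w, hwx, hwa, hwb⟩
      · exact ⟨v, hvx, hva, hvb⟩
    have hu0 : u ≠ 0 := by rintro rfl; exact hua a.zero_mem
    exact ⟨span R {u}, nonzero_span_atom u hu0, by simpa using hux, by simpa using hua,
      by simpa using hub⟩
  exists_coatom {x a b} ha hb := by
    obtain ⟨v, hva, hvx⟩ := SetLike.not_le_iff_exists.1 ha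
    obtain ⟨w, hwb, hwx⟩ := SetLike.not_le_iff_exists.1 hb
    obtain ⟨φ, hφv, hφ⟩ := exists_le_ker_of_notMem hvx
    obtain ⟨ψ, hψw, hψ⟩ := exists_le_ker_of_notMem hwx
    obtain ⟨χ, hχx, hχv, hχw⟩ : ∃ χ : V →ₗ[R] R, x ≤ LinearMap.ker χ ∧ χ v ≠ 0 ∧ χ w ≠ 0 := by
      by_cases h1 : φ w = 0
      · by_cases h2 : ψ v = 0
        · refine ⟨φ + ψ, fun u hu => ?_, by simpa [h2] using hφv, by simpa [h1] using hψw⟩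
          have h3 : φ u = 0 := hφ hu
          have h4 : ψ u = 0 := hψ hu
          simp [h3, h4]
        · exact ⟨ψ, hψ, h2, hψw⟩
      · exact ⟨φ, hφ, hφv, h1⟩
    refine ⟨LinearMap.ker χ, ?_, hχx, fun h => hχv (h hva), fun h => hχw (h hwb)⟩
    refine LinearMap.isCoatom_ker_of_surjective ?_
    exact LinearMap.surjective fun h => hχv (by rw [h]; rfl)
  inf_ne_bot {h h'} hh hh' h0 := by
    have h1 := finrank_of_isCoatom hh
    have h2 := finrank_of_isCoatom hh'
    have h3 := finrank_sup_add_finrank_inf_eq h h'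
    have h4 := (h ⊔ h').finrank_le
    rw [h0, finrank_bot] at h3
    omega
  sup_ne_top {p p'} hp hp' h0 := by
    have h3 := finrank_sup_add_finrank_inf_eq p p'
    obtain ⟨v, hv, rfl⟩ := (atom_iff_nonzero_span p).1 hp
    obtain ⟨w, hw, rfl⟩ := (atom_iff_nonzero_span p').1 hp'
    rw [h0, finrank_top, finrank_span_singleton hv, finrank_span_singleton hw] at h3
    omega

namespace GrassPair

open Submodule Module

variable {R V : Type*} [DivisionRing R] [AddCommGroup V] [Module R V] {k : ℕ}
  {b c : Frame R V} {I : Set (Fin (finrank R V))} {α : GrassPair R V k}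

/-- The antiflag formed by a coordinate line and the complementary coordinate hyperplane. -/
def flag (b : Frame R V) (x : Fin (finrank R V)) : Antiflag (Submodule R V) where
  pt := coordSpan b {x}
  hyp := coordSpan b {x}ᶜ
  isAtom := isAtom_coordSpan_singleton b x
  isCoatom := isCoatom_coordSpan_compl b x
  not_le := by simp

lemma exists_flag_eq [FiniteDimensional R V] (α : Antiflag (Submodule R V)) :
    ∃ (b : Frame R V) (x : _), flag b x = α := by
  have h : IsCompl α.hyp α.pt := by
    obtain ⟨v, -, hv⟩ := (atom_iff_nonzero_span _).1 α.isAtom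
    rw [hv]
    refine isCompl_span_singleton_of_isCoatom_of_notMem α.isCoatom ?_
    rw [← span_singleton_le_iff_mem, ← hv]
    exact α.not_le
  obtain ⟨b, I, h1, h2⟩ := exists_basis_of_isCompl h.symm
  obtain ⟨v, hv0, hv⟩ := (atom_iff_nonzero_span _).1 α.isAtom
  have h3 : I.ncard = 1 := by
    rw [← finrank_coordSpan b, ← h1, hv, finrank_span_singleton hv0]
  obtain ⟨x, rfl⟩ := Set.ncard_eq_one.1 h3
  exact ⟨b, x, Antiflag.ext h1.symm h2.symm⟩

lemma flag_comm (b : Frame R V) {x y : Fin (finrank R V)} (hxy : x ≠ y) :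
    Antiflag.Comm (flag b x) (flag b y) := by
  constructor <;> simp [flag, hxy, hxy.symm]

lemma antiflag_eq_of_le {α β : Antiflag (Submodule R V)} (h₁ : α.pt ≤ β.pt)
    (h₂ : α.hyp ≤ β.hyp) : α = β :=
  Antiflag.ext ((β.pt_le_iff α.isAtom).1 h₁) (α.isCoatom.le_iff_eq β.isCoatom.1 |>.1 h₂).symm

/-- Commuting antiflags are adapted to a common basis. -/
lemma exists_flag_eq_of_comm [FiniteDimensional R V] {α β : Antiflag (Submodule R V)}
    (h : Antiflag.Comm α β) : ∃ (b : Frame R V) (x y : _), x ≠ y ∧ flag b x = α ∧ flag b y = β := by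
  obtain ⟨c, y, rfl⟩ := exists_flag_eq β
  obtain ⟨v, hv0, hv⟩ := (atom_iff_nonzero_span _).1 α.isAtom
  have hvy : v ∈ coordSpan c {y}ᶜ := by
    rw [← span_singleton_le_iff_mem, ← hv]; exact h.1
  have hvα : v ∉ α.hyp := by
    rw [← span_singleton_le_iff_mem, ← hv]; exact α.not_le
  have hcy : c y ∈ α.hyp := mem_coordSpan_of_singleton_le h.2
  have hvy0 : c.repr v y = 0 := mem_coordSpan.1 hvy y (by simp)
  obtain ⟨x, hx⟩ : ∃ x, c.repr v x ≠ 0 := by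
    by_contra! h0
    exact hv0 (c.repr.map_eq_zero_iff.1 (Finsupp.ext h0))
  have hxy : x ≠ y := by rintro rfl; exact hx hvy0
  obtain ⟨d, hdx, hd⟩ := exists_basis_update c hx
  -- Project the remaining basis vectors onto the hyperplane of `α` along its point.
  choose a ha using exists_sub_smul_mem_of_isCoatom α.isCoatom hvα
  let u : Fin (finrank R V) → V := fun l => if l = x then v else d l - a (d l) • v
  have hux : u x = v := if_pos rfl
  have hu : ∀ l, l ≠ x → u l = d l - a (d l) • v := fun l hl => if_neg hl
  have hux' : v ∈ span R (Set.range u) := subset_span ⟨x, hux⟩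
  have htop : ⊤ ≤ span R (Set.range u) := by
    rw [← d.span_eq, span_le]
    rintro _ ⟨l, rfl⟩
    by_cases hl : l = x
    · rw [hl, hdx]; exact hux'
    · have : d l = u l + a (d l) • v := by rw [hu l hl, sub_add_cancel]
      rw [this]
      exact add_mem (subset_span ⟨l, rfl⟩) (smul_mem _ _ hux')
  let e : Frame R V := basisOfTopLeSpanOfCardEqFinrank u htop (by simp)
  have he : ∀ l, e l = u l := fun l => by simp [e]
  have hay : u y = c y := by
    have h1 := ha (d y)
    rw [hu y hxy.symm, hd y hxy.symm] at *
    have h2 : a (c y) • v ∈ α.hyp := by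
      have := sub_mem hcy h1
      rwa [sub_sub_cancel] at this
    rw [eq_zero_of_smul_mem hvα h2, zero_smul, sub_zero]
  refine ⟨e, x, y, hxy, antiflag_eq_of_le ?_ ?_, antiflag_eq_of_le ?_ ?_⟩
  · change coordSpan e {x} ≤ _
    rw [coordSpan_singleton, he, hux, hv]
  · refine coordSpan_le.2 fun l hl => ?_
    rw [he, hu l hl]
    exact ha _
  · change coordSpan e {y} ≤ coordSpan c {y}
    rw [coordSpan_singleton, he, hay, coordSpan_singleton]
  · refine coordSpan_le.2 fun l hl => ?_
    change e l ∈ coordSpan c {y}ᶜ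
    rw [he]
    by_cases hlx : l = x
    · rw [hlx, hux]; exact hvy
    · rw [hu l hlx, hd l hlx]
      exact sub_mem (by simpa using hl) (smul_mem _ _ hvy)

/-- A transformation preserving the class of base subsets induces a transformation of the
antiflags of `V` preserving commutation. -/
lemma exists_antiflag_equiv [FiniteDimensional R V] (hn : finrank R V = 2 * k) (hk : 4 ≤ k)
    {f : Equiv.Perm (GrassPair R V k)} (hf : f ∈ baseGroup R V k) :
    ∃ g : Antiflag (Submodule R V) ≃ Antiflag (Submodule R V),
      (∀ b c, Transports f b c → ∀ x, g (flag b x) = flag c x) ∧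
      ∀ α β, Antiflag.Comm (g α) (g β) ↔ Antiflag.Comm α β := by
  have key : ∀ f ∈ baseGroup R V k, ∃ g : Antiflag (Submodule R V) → Antiflag (Submodule R V),
      ∀ b c, Transports f b c → ∀ x, g (flag b x) = flag c x := by
    intro f hf
    choose B X hBX using exists_flag_eq (R := R) (V := V)
    choose C hC using exists_transports hn hk hf
    refine ⟨fun α => flag (C (B α)) (X α), fun b c hbc x => ?_⟩
    have h1 := hBX (flag b x)
    have h2 := (hC (B (flag b x))).coordSpan_eq hn hk hf hbc (congrArg Antiflag.pt h1)
      (congrArg Antiflag.hyp h1)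
    exact Antiflag.ext h2.1 h2.2
  obtain ⟨g, hg⟩ := key f hf
  obtain ⟨g', hg'⟩ := key f⁻¹ (inv_mem hf)
  have hinv : ∀ α, g' (g α) = α := fun α => by
    obtain ⟨b, x, rfl⟩ := exists_flag_eq α
    obtain ⟨c, hc⟩ := exists_transports hn hk hf b
    rw [hg b c hc, hg' c b (hc.symm hn hk)]
  have hinv' : ∀ α, g (g' α) = α := fun α => by
    obtain ⟨b, x, rfl⟩ := exists_flag_eq α
    obtain ⟨c, hc⟩ := exists_transports hn hk (inv_mem hf) b
    rw [hg' b c hc, hg c b (hc.symm hn hk)]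
  have hcomm : ∀ f ∈ baseGroup R V k, ∀ g : Antiflag (Submodule R V) → Antiflag (Submodule R V),
      (∀ b c, Transports f b c → ∀ x, g (flag b x) = flag c x) →
      ∀ α β, Antiflag.Comm α β → Antiflag.Comm (g α) (g β) := by
    intro f hf g hg α β h
    obtain ⟨b, x, y, hxy, rfl, rfl⟩ := exists_flag_eq_of_comm h
    obtain ⟨c, hc⟩ := exists_transports hn hk hf b
    rw [hg b c hc, hg b c hc]
    exact flag_comm c hxy
  refine ⟨⟨g, g', hinv, hinv'⟩, hg, fun α β => ⟨fun h => ?_, hcomm f hf g hg α β⟩⟩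
  have h1 := hcomm _ (inv_mem hf) g' hg' _ _ h
  change Antiflag.Comm (g' (g α)) (g' (g β)) at h1
  rwa [hinv, hinv] at h1

/-- Up to passing to the opposite, `f` acts on the components through the map `e` of subspaces. -/
def ActsBy (f : Equiv.Perm (GrassPair R V k)) (e : Submodule R V → Submodule R V) : Prop :=
  ∀ α, ((f α).fst = e α.fst ∧ (f α).snd = e α.snd) ∨ ((f α).fst = e α.snd ∧ (f α).snd = e α.fst)

/-- Up to passing to opposites, a transformation preserving the class of base subsets comes from
an isomorphism or an anti-isomorphism of the lattice of subspaces. -/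
theorem exists_actsBy [FiniteDimensional R V] (hn : finrank R V = 2 * k) (hk : 4 ≤ k)
    {f : Equiv.Perm (GrassPair R V k)} (hf : f ∈ baseGroup R V k) :
    (∃ Φ : Submodule R V ≃o Submodule R V, ActsBy f Φ) ∨
      ∃ Φ : Submodule R V ≃o (Submodule R V)ᵒᵈ, ActsBy f fun W => OrderDual.ofDual (Φ W) := by
  have := Submodule.projectiveLattice (R := R) (V := V) (by omega)
  obtain ⟨g, hg, hcomm⟩ := exists_antiflag_equiv hn hk hf
  rcases Antiflag.exists_orderIso_or_antiIso hcomm with ⟨Φ, hΦ⟩ | ⟨Φ, hΦ⟩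
  · refine Or.inl ⟨Φ, fun α => ?_⟩
    obtain ⟨b, I, hα⟩ := α.exists_mem_baseSubset
    obtain ⟨c, hc⟩ := exists_transports hn hk hf b
    have h1 : ∀ J, Φ (coordSpan b J) = coordSpan c J := by
      intro J
      rw [coordSpan_eq_iSup, coordSpan_eq_iSup c, Φ.map_iSup]
      refine iSup_congr fun i => ?_
      have := hΦ (flag b i)
      rwa [hg b c hc] at this
    rcases hc I α hα with h2 | h2
    · left; rw [h2.1, h2.2, hα.1, hα.2, h1, h1]; exact ⟨rfl, rfl⟩
    · right; rw [h2.1, h2.2, hα.1, hα.2, h1, h1, compl_compl]; exact ⟨rfl, rfl⟩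
  · refine Or.inr ⟨Φ, fun α => ?_⟩
    obtain ⟨b, I, hα⟩ := α.exists_mem_baseSubset
    obtain ⟨c, hc⟩ := exists_transports hn hk hf b
    have h1 : ∀ J, OrderDual.ofDual (Φ (coordSpan b J)) = coordSpan c Jᶜ := by
      intro J
      have h3 : ∀ i, OrderDual.ofDual (Φ (coordSpan b {i})) = coordSpan c {i}ᶜ := fun i => by
        have := hΦ (flag b i)
        rw [hg b c hc] at this
        exact congrArg OrderDual.ofDual this
      rw [coordSpan_eq_iSup, Φ.map_iSup, ofDual_iSup]
      ext v
      simp only [h3, mem_iInf, mem_coordSpan, Subtype.forall]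
      simp
    rcases hc I α hα with h2 | h2
    · right; simp only [h2.1, h2.2, hα.1, hα.2, h1, compl_compl, and_self]
    · left; simp only [h2.1, h2.2, hα.1, hα.2, h1, and_self]

end GrassPair

/-! ### Annihilators in the dual space -/

namespace GrassPair

open Submodule Module

variable {R V : Type*} [DivisionRing R] [AddCommGroup V] [Module R V]

/-- The annihilator in the dual space of a subspace of `V`. -/
def coannihilator (W : Submodule R V) : Submodule Rᵐᵒᵖ (Dual R V) where
  carrier := {φ | ∀ v ∈ W, φ v = 0}
  zero_mem' := fun _ _ => rfl
  add_mem' := fun {φ ψ} hφ hψ v hv => by rw [LinearMap.add_apply, hφ v hv, hψ v hv, add_zero]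
  smul_mem' := fun a φ hφ v hv => by rw [LinearMap.smul_apply, hφ v hv, smul_zero]

lemma annihilator_coannihilator (W : Submodule R V) : annihilator (coannihilator W) = W := by
  refine le_antisymm (fun v hv => ?_) fun v hv φ hφ => hφ v hv
  by_contra h
  obtain ⟨φ, hφv, hφ⟩ := exists_le_ker_of_notMem h
  exact hφv (hv φ fun w hw => hφ hw)

lemma finite_dual [FiniteDimensional R V] : Module.Finite Rᵐᵒᵖ (Dual R V) := by
  let b := finBasis R V
  refine ⟨fg_def.2 ⟨_, Set.finite_range b.coord, eq_top_iff.2 fun φ _ => ?_⟩⟩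
  have h : φ = ∑ i, MulOpposite.op (φ (b i)) • b.coord i := by
    refine b.ext fun j => ?_
    simp [LinearMap.sum_apply, Finsupp.single_apply]
  rw [h]
  exact sum_mem fun i _ => smul_mem _ _ (subset_span ⟨i, rfl⟩)

/-- A functional vanishing on the common kernel of finitely many others is a combination of them. -/
lemma coannihilator_annihilator [FiniteDimensional R V] (W : Submodule Rᵐᵒᵖ (Dual R V)) :
    coannihilator (annihilator W) = W := by
  refine le_antisymm (fun φ hφ => ?_) fun φ hφ v hv => hv φ hφ
  have := finite_dual (R := R) (V := V)
  obtain ⟨m, ψ, rfl⟩ := fg_iff_exists_fin_generating_family.1 (IsNoetherian.noetherian W)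
  let p : V →ₗ[R] Fin m → R := LinearMap.pi ψ
  have hker : LinearMap.ker p ≤ LinearMap.ker φ := fun v hv => by
    have hv' : ∀ i, ψ i v = 0 := fun i => congrFun hv i
    refine hφ v fun χ hχ => ?_
    induction hχ using span_induction with
    | mem χ h => obtain ⟨i, rfl⟩ := h; exact hv' i
    | zero => rfl
    | add χ χ' _ _ h h' => rw [LinearMap.add_apply, h, h', add_zero]
    | smul a χ _ h => rw [LinearMap.smul_apply, h, smul_zero]
  obtain ⟨χ, hχ⟩ : ∃ χ : (Fin m → R) →ₗ[R] R, χ.comp p = φ := by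
    obtain ⟨χ, hχ⟩ := (((LinearMap.ker p).liftQ φ hker).comp
      p.quotKerEquivRange.symm.toLinearMap).exists_extend
    refine ⟨χ, LinearMap.ext fun v => ?_⟩
    have h1 := LinearMap.congr_fun hχ ⟨p v, v, rfl⟩
    rw [LinearMap.comp_apply, LinearMap.comp_apply] at h1
    refine h1.trans ?_
    rw [LinearEquiv.coe_coe, LinearMap.quotKerEquivRange_symm_apply_image _ _ ⟨v, rfl⟩]
    rfl
  have h : φ = ∑ i, MulOpposite.op (χ (Pi.single i 1)) • ψ i := by
    rw [← hχ]
    ext v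
    rw [LinearMap.comp_apply, LinearMap.sum_apply, LinearMap.pi_apply_eq_sum_univ χ]
    have hs : ∀ i : Fin m, (fun j => if i = j then (1 : R) else 0) = Pi.single i 1 := fun i => by
      ext j; simp [Pi.single_apply, eq_comm]
    simp [p, hs]
  rw [h]
  exact sum_mem fun i _ => smul_mem _ _ (subset_span ⟨i, rfl⟩)

variable (R V) in
/-- Taking annihilators is an anti-isomorphism from the subspaces of the dual space to those of
`V`. -/
def annihilatorIso [FiniteDimensional R V] :
    Submodule Rᵐᵒᵖ (Dual R V) ≃o (Submodule R V)ᵒᵈ where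
  toFun W := OrderDual.toDual (annihilator W)
  invFun W := coannihilator (OrderDual.ofDual W)
  left_inv := coannihilator_annihilator
  right_inv W := annihilator_coannihilator (OrderDual.ofDual W)
  map_rel_iff' {W W'} := by
    refine ⟨fun h => ?_, fun h v hv φ hφ => hv φ (h hφ)⟩
    rw [← coannihilator_annihilator W, ← coannihilator_annihilator W']
    exact fun φ hφ v hv => hφ v (h hv)

/-! ### Transformations induced by isomorphisms and anti-isomorphisms of the lattice -/

/-- Lines spanning the space, as many as its dimension, are the coordinate lines of a basis. -/
lemma exists_basis_of_iSup_eq_top {P : Fin (finrank R V) → Submodule R V}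
    (hP : ∀ i, IsAtom (P i)) (htop : ⨆ i, P i = ⊤) :
    ∃ c : Frame R V, ∀ I : Set (Fin (finrank R V)), ⨆ i : I, P i = coordSpan c I := by
  choose v _ hv using fun i => (atom_iff_nonzero_span _).1 (hP i)
  have hspan : ⊤ ≤ span R (Set.range v) := by
    rw [span_range_eq_iSup, ← htop]
    exact iSup_mono fun i => (hv i).le
  refine ⟨basisOfTopLeSpanOfCardEqFinrank v hspan (by simp), fun I => ?_⟩
  rw [coordSpan_eq_iSup]
  refine iSup_congr fun i => ?_
  rw [coordSpan_singleton, hv, coe_basisOfTopLeSpanOfCardEqFinrank]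

lemma exists_basis_map (Φ : Submodule R V ≃o Submodule R V) (b : Frame R V) :
    ∃ c : Frame R V, ∀ I, Φ (coordSpan b I) = coordSpan c I := by
  obtain ⟨c, hc⟩ := exists_basis_of_iSup_eq_top (P := fun i => Φ (coordSpan b {i}))
    (fun i => (Φ.isAtom_iff _).2 (isAtom_coordSpan_singleton b i)) (by
      rw [← Φ.map_iSup, ← Φ.map_top, ← b.span_eq, span_range_eq_iSup]
      simp only [coordSpan_singleton])
  refine ⟨c, fun I => ?_⟩
  rw [← hc, coordSpan_eq_iSup, Φ.map_iSup]

lemma coordSpan_eq_iInf {ι : Type*} (b : Basis ι R V) (I : Set ι) :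
    coordSpan b I = ⨅ i : ↥Iᶜ, coordSpan b {(i : ι)}ᶜ := by
  ext v
  simp [mem_coordSpan, mem_iInf]

lemma exists_basis_antimap (Φ : Submodule R V ≃o (Submodule R V)ᵒᵈ) (b : Frame R V) :
    ∃ c : Frame R V, ∀ I, OrderDual.ofDual (Φ (coordSpan b I)) = coordSpan c Iᶜ := by
  have hmap : ∀ I, OrderDual.ofDual (Φ (coordSpan b I)) =
      ⨆ i : ↥Iᶜ, OrderDual.ofDual (Φ (coordSpan b {(i : Fin _)}ᶜ)) := fun I => by
    rw [coordSpan_eq_iInf b I, Φ.map_iInf, ofDual_iInf]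
  obtain ⟨c, hc⟩ := exists_basis_of_iSup_eq_top
    (P := fun i => OrderDual.ofDual (Φ (coordSpan b {i}ᶜ)))
    (fun i => isCoatom_dual_iff_isAtom.1 ((Φ.isCoatom_iff _).2 (isCoatom_coordSpan_compl b i))) (by
      have h := hmap ∅
      rw [coordSpan_empty, Φ.map_bot] at h
      refine top_le_iff.1 (h.le.trans (iSup_le fun i => ?_))
      exact le_iSup (fun i => OrderDual.ofDual (Φ (coordSpan b {i}ᶜ))) i)
  exact ⟨c, fun I => by rw [← hc, hmap]⟩

end GrassPair

namespace GrassPair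

open Submodule Module

variable {R V : Type*} [DivisionRing R] [AddCommGroup V] [Module R V] {k : ℕ}
  {f g : Equiv.Perm (GrassPair R V k)} {e : Submodule R V → Submodule R V}
  {α β γ : GrassPair R V k}

/-! ### Transformations acting through maps of subspaces -/

/-- `e` maps the coordinate subspaces of `b` bijectively to those of `c`. -/
def MapsFrame (e : Submodule R V → Submodule R V) (b c : Frame R V) : Prop :=
  ∃ ρ : Set (Fin (finrank R V)) → Set (Fin (finrank R V)), Function.Surjective ρ ∧
    ∀ I, e (coordSpan b I) = coordSpan c (ρ I)

lemma ActsBy.image_baseSubset (hf : ActsBy f e) (he : Function.Injective e) {b c : Frame R V}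
    (h : MapsFrame e b c) : f '' baseSubset k b = baseSubset k c := by
  obtain ⟨ρ, hρ, h⟩ := h
  have h1 : ∀ W, (∃ I, e W = span R (c '' I)) ↔ ∃ I, W = span R (b '' I) := by
    intro W
    constructor
    · rintro ⟨J, hJ⟩
      obtain ⟨I, rfl⟩ := hρ J
      exact ⟨I, he (hJ.trans (h I).symm)⟩
    · rintro ⟨I, rfl⟩
      exact ⟨ρ I, h I⟩
  have h2 : ∀ α, f α ∈ baseSubset k c ↔ α ∈ baseSubset k b := by
    intro α
    rcases hf α with h3 | h3
    · simp only [baseSubset, Set.mem_ofPred_eq, h3.1, h3.2, h1]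
    · simp only [baseSubset, Set.mem_ofPred_eq, h3.1, h3.2, h1]
      exact and_comm
  ext β
  rw [f.image_eq_preimage_symm, Set.mem_preimage, ← h2, f.apply_symm_apply]

lemma ActsBy.mem_baseGroup (hf : ActsBy f e) (he : Function.Injective e)
    (h₁ : ∀ b : Frame R V, ∃ c, MapsFrame e b c) (h₂ : ∀ c : Frame R V, ∃ b, MapsFrame e b c) :
    f ∈ baseGroup R V k := by
  intro A
  constructor
  · rintro ⟨c, hc⟩
    obtain ⟨b, hb⟩ := h₂ c
    refine ⟨b, f.injective.image_injective ?_⟩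
    rw [hc, hf.image_baseSubset he hb]
  · rintro ⟨b, rfl⟩
    obtain ⟨c, hc⟩ := h₁ b
    exact ⟨c, hf.image_baseSubset he hc⟩

lemma ActsBy.mem_baseGroup_of_orderIso {Φ : Submodule R V ≃o Submodule R V} (hf : ActsBy f Φ) :
    f ∈ baseGroup R V k := by
  refine hf.mem_baseGroup Φ.injective (fun b => ?_) fun c => ?_
  · obtain ⟨c, hc⟩ := exists_basis_map Φ b
    exact ⟨c, id, Function.surjective_id, hc⟩
  · obtain ⟨b, hb⟩ := exists_basis_map Φ.symm c
    exact ⟨b, id, Function.surjective_id, fun I => by rw [← hb, Φ.apply_symm_apply]; rfl⟩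

lemma ActsBy.mem_baseGroup_of_antiIso {Φ : Submodule R V ≃o (Submodule R V)ᵒᵈ}
    (hf : ActsBy f fun W => OrderDual.ofDual (Φ W)) : f ∈ baseGroup R V k := by
  refine hf.mem_baseGroup (OrderDual.ofDual.injective.comp Φ.injective) (fun b => ?_) fun c => ?_
  · obtain ⟨c, hc⟩ := exists_basis_antimap Φ b
    exact ⟨c, compl, compl_surjective, hc⟩
  · obtain ⟨b, hb⟩ := exists_basis_antimap
      ((OrderIso.dualDual (Submodule R V)).trans Φ.symm.dual) c
    refine ⟨b, compl, compl_surjective, fun I => ?_⟩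
    have h : Φ.symm (OrderDual.toDual (coordSpan c Iᶜ)) = coordSpan b I := by
      rw [← compl_compl I, ← hb, compl_compl]; rfl
    simp only [← h, Φ.apply_symm_apply, OrderDual.ofDual_toDual]

lemma mem_baseGroup_of_semilinear [FiniteDimensional R V]
    (hf : f ∈ semilinearTransformations R V k) : f ∈ baseGroup R V k := by
  rcases hf with ⟨σ, l, hl, h⟩ | ⟨σ, s, hs, h⟩
  · exact ActsBy.mem_baseGroup_of_orderIso (Φ := orderIsoMapComapOfBijective l hl)
      fun α => Or.inl (h α)
  · exact ActsBy.mem_baseGroup_of_antiIso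
      (Φ := (orderIsoMapComapOfBijective s hs).trans (annihilatorIso R V))
      fun α => Or.inr (h α)

/-! ### Transformations realizing a lattice isomorphism or anti-isomorphism -/

lemma exists_perm_of_orderIso [FiniteDimensional R V] (Φ : Submodule R V ≃o Submodule R V) :
    ∃ g : Equiv.Perm (GrassPair R V k), ∀ α, (g α).fst = Φ α.fst ∧ (g α).snd = Φ α.snd := by
  have hrank : ∀ (Φ : Submodule R V ≃o Submodule R V) (W : Submodule R V),
      finrank R (Φ W) = finrank R W := by
    intro Φ W
    obtain ⟨U, hU⟩ := Submodule.exists_isCompl W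
    obtain ⟨b, I, rfl, -⟩ := exists_basis_of_isCompl hU
    obtain ⟨c, hc⟩ := exists_basis_map Φ b
    rw [hc, finrank_coordSpan, finrank_coordSpan]
  let F : (Submodule R V ≃o Submodule R V) → GrassPair R V k → GrassPair R V k := fun Φ α =>
    ⟨Φ α.fst, Φ α.snd, by rw [hrank, α.finrank_fst], by rw [hrank, α.finrank_snd], by
      rw [← Φ.map_sup, α.sup_eq_top, Φ.map_top]⟩
  exact ⟨⟨F Φ, F Φ.symm, fun α => GrassPair.ext (by simp [F]) (by simp [F]),
    fun α => GrassPair.ext (by simp [F]) (by simp [F])⟩, fun α => ⟨rfl, rfl⟩⟩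

lemma exists_perm_of_antiIso [FiniteDimensional R V] (hn : finrank R V = 2 * k)
    (Φ : Submodule R V ≃o (Submodule R V)ᵒᵈ) :
    ∃ g : Equiv.Perm (GrassPair R V k), ∀ α,
      (g α).fst = OrderDual.ofDual (Φ α.snd) ∧ (g α).snd = OrderDual.ofDual (Φ α.fst) := by
  have hrank : ∀ (Φ : Submodule R V ≃o (Submodule R V)ᵒᵈ) (W : Submodule R V),
      finrank R W = k → finrank R (OrderDual.ofDual (Φ W) : Submodule R V) = k := by
    intro Φ W hW
    obtain ⟨U, hU⟩ := Submodule.exists_isCompl W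
    obtain ⟨b, I, rfl, -⟩ := exists_basis_of_isCompl hU
    obtain ⟨c, hc⟩ := exists_basis_antimap Φ b
    rw [finrank_coordSpan] at hW
    rw [hc, finrank_coordSpan, Set.ncard_compl, hW, Nat.card_fin]
    omega
  have hsnd : ∀ α : GrassPair R V k, finrank R α.snd = k := fun α => by
    rw [α.finrank_snd]; omega
  let F : (Submodule R V ≃o (Submodule R V)ᵒᵈ) → GrassPair R V k → GrassPair R V k := fun Φ α =>
    ⟨OrderDual.ofDual (Φ α.snd), OrderDual.ofDual (Φ α.fst), hrank Φ _ (hsnd α),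
      by rw [hrank Φ _ α.finrank_fst]; omega, by
      rw [← ofDual_inf, ← Φ.map_inf, α.isCompl.symm.inf_eq_bot, Φ.map_bot]; rfl⟩
  let Ψ : Submodule R V ≃o (Submodule R V)ᵒᵈ :=
    (OrderIso.dualDual (Submodule R V)).trans Φ.symm.dual
  have h1 : ∀ W, OrderDual.ofDual (Ψ (OrderDual.ofDual (Φ W))) = W := fun W =>
    Φ.symm_apply_apply W
  have h2 : ∀ W, OrderDual.ofDual (Φ (OrderDual.ofDual (Ψ W))) = W := fun W =>
    congrArg OrderDual.ofDual (Φ.apply_symm_apply (OrderDual.toDual W))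
  exact ⟨⟨F Φ, F Ψ, fun α => GrassPair.ext (h1 _) (h1 _),
    fun α => GrassPair.ext (h2 _) (h2 _)⟩, fun α => ⟨rfl, rfl⟩⟩

/-- A transformation preserving the class of base subsets agrees up to opposites with one induced
by a semilinear isomorphism. -/
lemma exists_semilinear_actsBy [FiniteDimensional R V] (hn : finrank R V = 2 * k) (hk : 4 ≤ k)
    (hf : f ∈ baseGroup R V k) :
    ∃ e, ActsBy f e ∧
      ∃ g ∈ semilinearTransformations R V k, ActsBy g e := by
  rcases exists_actsBy hn hk hf with ⟨Φ, hΦ⟩ | ⟨Φ, hΦ⟩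
  · obtain ⟨g, hg⟩ := exists_perm_of_orderIso (k := k) Φ
    obtain ⟨σ, l, hl, hl'⟩ := exists_semilinear_of_orderIso (by omega) Φ
    refine ⟨Φ, hΦ, g, Or.inl ⟨σ, l, hl, fun α => ?_⟩, fun α => Or.inl (hg α)⟩
    rw [← hl', ← hl']; exact hg α
  · obtain ⟨g, hg⟩ := exists_perm_of_antiIso hn Φ
    obtain ⟨σ, s, hs, hs'⟩ := exists_semilinear_of_orderIso (by omega)
      (Φ.trans (annihilatorIso R V).symm)
    have h : ∀ W : Submodule R V, annihilator (W.map s) = OrderDual.ofDual (Φ W) := fun W => by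
      rw [← hs']
      exact congrArg OrderDual.ofDual ((annihilatorIso R V).apply_symm_apply (Φ W))
    refine ⟨_, hΦ, g,
      Or.inr ⟨σ, s, hs, fun α => ?_⟩, fun α => Or.inr (hg α)⟩
    rw [h, h]; exact hg α

/-! ### Opposite elements -/

lemma IsOpposite.symm (h : IsOpposite α β) : IsOpposite β α := ⟨h.2.symm, h.1.symm⟩

lemma IsOpposite.eq (h : IsOpposite α β) (h' : IsOpposite α γ) : β = γ :=
  GrassPair.ext (h.1.trans h'.1.symm) (h.2.trans h'.2.symm)

lemma exists_isOpposite (hn : finrank R V = 2 * k) (α : GrassPair R V k) : ∃ β, IsOpposite α β :=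
  ⟨⟨α.snd, α.fst, by rw [α.finrank_snd]; omega, by rw [α.finrank_fst]; omega,
    by rw [sup_comm, α.sup_eq_top]⟩, rfl, rfl⟩

lemma ActsBy.eq_or_isOpposite (hf : ActsBy f e) (hg : ActsBy g e) (α : GrassPair R V k) :
    g α = f α ∨ IsOpposite (f α) (g α) := by
  rcases hf α with h | h <;> rcases hg α with h' | h'
  · exact Or.inl (GrassPair.ext (h'.1.trans h.1.symm) (h'.2.trans h.2.symm))
  · exact Or.inr ⟨h'.1.trans h.2.symm, h'.2.trans h.1.symm⟩
  · exact Or.inr ⟨h'.1.trans h.2.symm, h'.2.trans h.1.symm⟩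
  · exact Or.inl (GrassPair.ext (h'.1.trans h.1.symm) (h'.2.trans h.2.symm))

lemma ActsBy.isOpposite (hf : ActsBy f e) (h : IsOpposite α β) :
    IsOpposite (f α) (f β) := by
  by_cases hne : f α = f β
  · obtain rfl := f.injective hne
    have h1 : α.fst = α.snd := h.1
    rcases hf α with h' | h' <;> exact ⟨by rw [h'.1, h'.2, h1], by rw [h'.1, h'.2, h1]⟩
  · rcases hf α with h1 | h1 <;> rcases hf β with h2 | h2 <;> rw [h.1, h.2] at h2
    · exact ⟨h2.1.trans h1.2.symm, h2.2.trans h1.1.symm⟩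
    · exact absurd (GrassPair.ext (h1.1.trans h2.1.symm) (h1.2.trans h2.2.symm)) hne
    · exact absurd (GrassPair.ext (h1.1.trans h2.1.symm) (h1.2.trans h2.2.symm)) hne
    · exact ⟨h2.1.trans h1.2.symm, h2.2.trans h1.1.symm⟩

lemma isOpposite_map_iff [FiniteDimensional R V] (hn : finrank R V = 2 * k) (hk : 4 ≤ k)
    (hf : f ∈ baseGroup R V k) : IsOpposite (f α) (f β) ↔ IsOpposite α β := by
  have key : ∀ f ∈ baseGroup R V k, ∀ α β : GrassPair R V k, IsOpposite α β →
      IsOpposite (f α) (f β) := by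
    intro f hf α β h
    obtain ⟨e, he, -⟩ := exists_semilinear_actsBy hn hk hf
    exact he.isOpposite h
  refine ⟨fun h => ?_, key f hf α β⟩
  simpa using key f⁻¹ (inv_mem hf) _ _ h

lemma ActsBy.image_pair_subset (hf : ActsBy f e) (hg : ActsBy g e) (h : IsOpposite α β) :
    g '' {α, β} ⊆ f '' {α, β} := by
  rintro _ ⟨γ, rfl | rfl, rfl⟩
  · rcases hf.eq_or_isOpposite hg γ with h' | h'
    · exact ⟨γ, by simp, h'.symm⟩
    · exact ⟨β, by simp, (hf.isOpposite h).eq h'⟩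
  · rcases hf.eq_or_isOpposite hg γ with h' | h'
    · exact ⟨γ, by simp, h'.symm⟩
    · exact ⟨α, by simp, (hf.isOpposite h.symm).eq h'⟩

lemma ActsBy.image_eq (hf : ActsBy f e) (hg : ActsBy g e) {A : Set (GrassPair R V k)}
    (hA : A ∈ oppositePairs R V k) : f '' A = g '' A := by
  obtain ⟨α, β, h, rfl⟩ := hA
  exact (hg.image_pair_subset hf h).antisymm (hf.image_pair_subset hg h)

lemma image_mem_oppositePairs [FiniteDimensional R V] (hn : finrank R V = 2 * k) (hk : 4 ≤ k)
    (hf : f ∈ baseGroup R V k) {A : Set (GrassPair R V k)} (hA : A ∈ oppositePairs R V k) :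
    f '' A ∈ oppositePairs R V k := by
  obtain ⟨α, β, h, rfl⟩ := hA
  exact ⟨f α, f β, (isOpposite_map_iff hn hk hf).2 h, Set.image_pair _ _ _⟩

lemma actsBy_id_of_mem_opTransformations (hf : f ∈ opTransformations R V k) : ActsBy f id := by
  obtain ⟨X, -, h1, h2⟩ := hf
  intro α
  by_cases h : α ∈ X
  · exact Or.inr (h1 α h)
  · rw [h2 α h]; exact Or.inl ⟨rfl, rfl⟩

lemma mem_baseGroup_of_mem_opTransformations (hf : f ∈ opTransformations R V k) :
    f ∈ baseGroup R V k :=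
  ActsBy.mem_baseGroup_of_orderIso (Φ := OrderIso.refl _) (actsBy_id_of_mem_opTransformations hf)

/-- A transformation fixing all pairs of opposite elements exchanges the members of some of these
pairs and fixes everything else. -/
lemma mem_opTransformations_iff [FiniteDimensional R V] (hn : finrank R V = 2 * k) :
    f ∈ opTransformations R V k ↔ ∀ A ∈ oppositePairs R V k, f '' A = A := by
  constructor
  · intro hf A hA
    have h1 : ActsBy (1 : Equiv.Perm (GrassPair R V k)) id := fun α => Or.inl ⟨rfl, rfl⟩
    simpa using (actsBy_id_of_mem_opTransformations hf).image_eq h1 hA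
  · intro hf
    have h1 : ∀ α β, IsOpposite α β → f α = α ∨ f α = β := fun α β h => by
      have : f α ∈ ({α, β} : Set (GrassPair R V k)) := by
        rw [← hf _ ⟨α, β, h, rfl⟩]; exact ⟨α, by simp, rfl⟩
      simpa using this
    refine ⟨{α | f α ≠ α}, fun α β hα h => fun hβ => ?_, fun α hα => ?_, fun α hα => ?_⟩
    · exact hα (f.injective (((h1 α β h).resolve_left hα) ▸ hβ))
    · obtain ⟨β, h⟩ := exists_isOpposite hn α
      rw [(h1 α β h).resolve_left hα]
      exact h
    · by_contra h
      exact hα h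

end GrassPair

/-! ### The group of transformations preserving base subsets -/

theorem theorem2 {R V : Type*} [DivisionRing R] [AddCommGroup V] [Module R V]
    [FiniteDimensional R V] (k : ℕ) (hn : Module.finrank R V = 2 * k) (hk : 8 ≤ 2 * k) :
    (∀ f ∈ GrassPair.baseGroup R V k,
      (∀ α β : GrassPair R V k,
        GrassPair.IsOpposite (f α) (f β) ↔ GrassPair.IsOpposite α β) ∧
      ∃ F : Equiv.Perm (GrassPair.oppositePairs R V k),
        (∀ A : GrassPair.oppositePairs R V k,
          (F A : Set (GrassPair R V k)) = f '' (A : Set (GrassPair R V k))) ∧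
        ∃ g ∈ GrassPair.semilinearTransformations R V k,
          ∀ A : GrassPair.oppositePairs R V k,
            (F A : Set (GrassPair R V k)) = g '' (A : Set (GrassPair R V k))) ∧
    GrassPair.baseGroup R V k =
      Subgroup.closure
        (GrassPair.opTransformations R V k ∪ GrassPair.semilinearTransformations R V k) ∧
    {f | f ∈ GrassPair.baseGroup R V k ∧
        ∀ A ∈ GrassPair.oppositePairs R V k, f '' A = A} =
      GrassPair.opTransformations R V k := by
  have hk' : 4 ≤ k := by omega
  refine ⟨fun f hf => ⟨fun α β => GrassPair.isOpposite_map_iff hn hk' hf, ?_⟩, ?_, ?_⟩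
  · obtain ⟨e, he, g, hg, hge⟩ := GrassPair.exists_semilinear_actsBy hn hk' hf
    refine ⟨⟨fun A => ⟨f '' A, GrassPair.image_mem_oppositePairs hn hk' hf A.2⟩,
      fun A => ⟨(f⁻¹ : Equiv.Perm (GrassPair R V k)) '' A,
        GrassPair.image_mem_oppositePairs hn hk' (inv_mem hf) A.2⟩,
      fun A => Subtype.ext ?_, fun A => Subtype.ext ?_⟩, fun A => rfl, g, hg,
      fun A => he.image_eq hge A.2⟩
    · simp [← Set.image_comp]
    · simp [← Set.image_comp]
  · apply le_antisymm
    · intro f hf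
      obtain ⟨e, he, g, hg, hge⟩ := GrassPair.exists_semilinear_actsBy hn hk' hf
      -- `f` differs from the semilinear transformation `g` by an element of `Op`.
      have h1 : g⁻¹ * f ∈ GrassPair.opTransformations R V k := by
        rw [GrassPair.mem_opTransformations_iff hn]
        intro A hA
        rw [Equiv.Perm.coe_mul, Set.image_comp, he.image_eq hge hA, ← Set.image_comp,
          ← Equiv.Perm.coe_mul, inv_mul_cancel, Equiv.Perm.coe_one, Set.image_id]
      have h2 : f = g * (g⁻¹ * f) := by group
      rw [h2]
      exact mul_mem (Subgroup.subset_closure (Or.inr hg)) (Subgroup.subset_closure (Or.inl h1))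
    · rw [Subgroup.closure_le]
      rintro f (hf | hf)
      · exact GrassPair.mem_baseGroup_of_mem_opTransformations hf
      · exact GrassPair.mem_baseGroup_of_semilinear hf
  · ext f
    rw [GrassPair.mem_opTransformations_iff hn]
    exact ⟨fun h => h.2, fun h => ⟨GrassPair.mem_baseGroup_of_mem_opTransformations
      ((GrassPair.mem_opTransformations_iff hn).2 h), h⟩⟩
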